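/- **Theorem 2.6.** For complex $q$ with $0<|q|<1$ put $(x;q)_k=\prod_{i=0}^{k-1}(1-xq^i)$ for $k\in\mathbb N_0$ and $(x;q)_\infty=\prod_{i=0}^{\infty}(1-xq^i)$; a list of arguments, as in $(u,v,\dots;q)_k$, denotes the product of the corresponding factorials, and $$\left[\begin{matrix}u,v,\dots\\ \alpha,\beta,\dots\end{matrix};q\right]_k=\frac{(u,v,\dots;q)_k}{(\alpha,\beta,\dots;q)_k}\qquad(k\in\mathbb N_0\cup\{\infty\}).$$ Let $n\ge 0$, let $a,b,c,d,e,x_1,\dots,x_n,y_1,\dots,y_n$ be nonzero complex numbers and $N_1,\dots,N_n\in\mathbb N_0$, $N=\sum_{\iota=1}^nN_\iota$, such that $$\frac{ab}{x_\iota y_\iota}=q^{N_\iota}\quad(1\le\iota\le n),\qquad \left|\frac{cde}{abq^{N+1}}\right|<1.$$ Assume that no denominator occurring in the formulas below vanishes (in the multiple sum, this is required only for the terms with $m_\iota\le N_\iota$ for all $\iota$; all other terms contain a factor $(q^{-N_\iota};q)_{m_\iota}=0$ and are read as $0$). Put $$\rho(a,b;c,d,e,\{x_\iota,y_\iota\}_{\iota=1}^n)=\frac1{b^n}\sum_{k=0}^\infty\Big(1-\frac{aq^{2k+1}}{b}\Big)\frac{(-1/b;q)_{k+1}}{(-qa;q)_k}\,\frac{(-qa/c,-qa/d,-qa/e,\{-qa/x_\iota,-qa/y_\iota\}_{\iota=1}^n;q)_k}{(-c/b,-d/b,-e/b,\{-x_\iota/b,-y_\iota/b\}_{\iota=1}^n;q)_{k+1}}\Big(\frac{cde}{abq^{N+1}}\Big)^k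 .$$ Then the series for $\rho(a,b;\dots)$ and $\rho(b,a;\dots)$ and the multiple sum below converge, and $$\begin{aligned} &\rho(a,b;c,d,e,\{x_\iota,y_\iota\}_{\iota=1}^n)-\rho(b,a;c,d,e,\{x_\iota,y_\iota\}_{\iota=1}^n)\\ &=\Big(\frac1b-\frac1a\Big)\left[\begin{matrix}q,qa/b,qb/a,c,d,e,cd/ab,ce/ab,de/ab\\-qa,-qb,-c/a,-c/b,-d/a,-d/b,-e/a,-e/b,cde/qab\end{matrix};q\right]_\infty\\ &\quad\times\prod_{\iota=1}^n\frac1{x_\iota}\left[\begin{matrix}-qa/x_\iota,-qb/x_\iota,qy_\iota/e,ey_\iota/ab\\e/x_\iota,qab/ex_\iota,-y_\iota/a,-y_\iota/b\end{matrix};q\right]_\infty\\ &\quad\times\sum_{m\in\mathbb N_0^n}\left[\begin{matrix}x_ny_n/ab\\q\end{matrix};q\right]_{m_n}\left[\begin{matrix}q/e,qab/ce,qab/de\\qx_n/e,qy_n/e,q^2ab/cde\end{matrix};q\right]_{M_n}q^{M_n}\\ &\qquad\times\prod_{s=1}^{n-1}\left[\begin{matrix}x_sy_s/ab\\q\end{matrix};q\right]_{m_s}\left[\begin{matrix}qab/ex_{s+1},qab/ey_{s+1}\\qx_s/e,qy_s/e\end{matrix};q\right]_{M_s}\Big(\frac{x_{s+1}y_{s+1}}{ab}\Big)^{M_s},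 \end{aligned}$$ where $M_s=m_1+\dots+m_s$, fractions such as $cd/ab$, $qab/ex$ and $cde/qab$ mean $(cd)/(ab)$, $(qab)/(ex)$ and $(cde)/(qab)$, and for $n=0$ the multiple sum is read as $1$. -/

import Mathlib

open scoped BigOperators

noncomputable section

namespace RamanujanReciprocity

/-- The finite `q`-shifted factorial `(x; q)_n = ∏_{i=0}^{n-1} (1 - x q^i)`. -/
def qPoch (q x : ℂ) (n : ℕ) : ℂ := ∏ i ∈ Finset.range n, (1 - x * q ^ i)

/-- The infinite `q`-shifted factorial `(x; q)_∞ = ∏_{k=0}^∞ (1 - x q^k)`, used for `|q| < 1`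
(where the product converges unconditionally). -/
def qPochInf (q x : ℂ) : ℂ := ∏' k : ℕ, (1 - x * q ^ k)

/-- No factor `1 - x q^k` (`k = 0, 1, 2, …`) vanishes; for `|q| < 1` this says that `(x; q)_∞`,
equivalently every `(x; q)_k`, is nonzero. -/
def QNonvanishing (q x : ℂ) : Prop := ∀ k : ℕ, 1 - x * q ^ k ≠ 0

/-- The `k`-th term of the series in `ρ(a, b; c, d, e, {x_ι, y_ι})`; here `N` is the sum of
the `N_ι`. -/
def rhoTerm {n : ℕ} (q a b c d e : ℂ) (x y : Fin n → ℂ) (N : ℕ) (k : ℕ) : ℂ :=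
  (1 - a * q ^ (2 * k + 1) / b)
    * (qPoch q (-1 / b) (k + 1) / qPoch q (-(q * a)) k)
    * ((qPoch q (-(q * a / c)) k * qPoch q (-(q * a / d)) k * qPoch q (-(q * a / e)) k
          * ∏ i, (qPoch q (-(q * a / x i)) k * qPoch q (-(q * a / y i)) k))
        / (qPoch q (-(c / b)) (k + 1) * qPoch q (-(d / b)) (k + 1) * qPoch q (-(e / b)) (k + 1)
          * ∏ i, (qPoch q (-(x i / b)) (k + 1) * qPoch q (-(y i / b)) (k + 1))))
    * (c * d * e / (a * b * q ^ (N + 1))) ^ k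

/-- `ρ(a, b; c, d, e, {x_ι, y_ι})`. -/
def rho {n : ℕ} (q a b c d e : ℂ) (x y : Fin n → ℂ) (N : ℕ) : ℂ :=
  1 / b ^ n * ∑' k : ℕ, rhoTerm q a b c d e x y N k

/-- The product side of the five-variable reciprocity formula. -/
def fiveVarProduct (q a b c d e : ℂ) : ℂ :=
  (1 / b - 1 / a) *
    ((qPochInf q q * qPochInf q (q * a / b) * qPochInf q (q * b / a)
        * qPochInf q c * qPochInf q d * qPochInf q e
        * qPochInf q (c * d / (a * b)) * qPochInf q (c * e / (a * b))
        * qPochInf q (d * e / (a * b)))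
      / (qPochInf q (-(q * a)) * qPochInf q (-(q * b))
        * qPochInf q (-(c / a)) * qPochInf q (-(c / b))
        * qPochInf q (-(d / a)) * qPochInf q (-(d / b))
        * qPochInf q (-(e / a)) * qPochInf q (-(e / b))
        * qPochInf q (c * d * e / (q * a * b))))

/-- The further factor contributed by one pair `(x, y) = (x_ι, y_ι)`. -/
def pairProduct (q a b e x y : ℂ) : ℂ :=
  1 / x *
    ((qPochInf q (-(q * a / x)) * qPochInf q (-(q * b / x))
        * qPochInf q (q * y / e) * qPochInf q (e * y / (a * b)))
      / (qPochInf q (e / x) * qPochInf q (q * a * b / (e * x))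
        * qPochInf q (-(y / a)) * qPochInf q (-(y / b))))

/-- The partial sum `M_s = m_1 + ⋯ + m_s`, where `s : Fin n` counts the indices from zero. -/
def partialSum {n : ℕ} (m : Fin n → ℕ) (s : Fin n) : ℕ := ∑ i ∈ Finset.Iic s, m i

/-- The summand of the multiple sum at `m = (m_1, …, m_n)`. For `n ≥ 1` the last index plays the
role of `n` and the product runs over the other indices `s`, with `s + 1` the next one; for
`n = 0` the only (empty) tuple contributes `1`. -/
def multiTerm : {n : ℕ} → (q a b c d e : ℂ) → (x y : Fin n → ℂ) → (m : Fin n → ℕ) → ℂ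
  | 0, _, _, _, _, _, _, _, _, _ => 1
  | n + 1, q, a, b, c, d, e, x, y, m =>
    let l : Fin (n + 1) := Fin.last n
    (qPoch q (x l * y l / (a * b)) (m l) / qPoch q q (m l))
      * ((qPoch q (q / e) (partialSum m l) * qPoch q (q * a * b / (c * e)) (partialSum m l)
            * qPoch q (q * a * b / (d * e)) (partialSum m l))
          / (qPoch q (q * x l / e) (partialSum m l) * qPoch q (q * y l / e) (partialSum m l)
            * qPoch q (q ^ 2 * a * b / (c * d * e)) (partialSum m l)))
      * q ^ partialSum m l
      * ∏ s : Fin n,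
          ((qPoch q (x s.castSucc * y s.castSucc / (a * b)) (m s.castSucc)
              / qPoch q q (m s.castSucc))
            * ((qPoch q (q * a * b / (e * x s.succ)) (partialSum m s.castSucc)
                  * qPoch q (q * a * b / (e * y s.succ)) (partialSum m s.castSucc))
                / (qPoch q (q * x s.castSucc / e) (partialSum m s.castSucc)
                  * qPoch q (q * y s.castSucc / e) (partialSum m s.castSucc)))
            * (x s.succ * y s.succ / (a * b)) ^ partialSum m s.castSucc)

end RamanujanReciprocity

end

/-!
The difference `ρ(a, b; …) - ρ(b, a; …)` is a bilateral very-well-poised series: the second series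
supplies, up to sign, the terms with negative index of the first. The theorem is Bailey's `₆ψ₆`
summation when there are no pairs `(x_ι, y_ι)`, and each pair is removed by a finite expansion.

*Regularization.* Multiplying the series by `(-f/a, -f/b; q)_∞` for `f = c, d, e` turns the factor
of `f` into `regFactor q a b f k`, which has no denominator and makes sense for every `f`. This
matters because the proof replaces `c` by `c q^m` and `0`, and `e` by `e / q^m`, and the
original terms may be undefined there.

*No pairs.* The regularized difference `regSum` satisfies a first-order contiguous relation under
`c ↦ c q`: the corresponding combination of the terms telescopes (`regTerm_contiguous`), and the
boundary terms of the two one-sided series cancel. Iterating and letting `c q^m → 0` by dominated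
convergence, for `c`, `d` and `e` in turn, expresses `regSum` by its value at `c = d = e = 0`. This
value, which depends on `a` and `b` only, is read off from `c = -qa`, `d = -qb`, `e = 0`, where only
the terms with index `0` survive. The result is `regSum_eq`.

*Pairs.* Since `ab / (xy) = q^N`, the factor of a pair at the index `k` is a constant times
`∏_{i < N} (s_k + φ(x q^i))`, where `s_k = indexVal q a b k` and `φ = nodeVal q a b`, while
passing from `e` to `e / q^m` multiplies `regFactor q a b e k` by a constant times
`∏_{i < m} (s_k + φ(e q^{-i-1}))` (`regFactor_div_pow`). Newton interpolation at the nodes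
`e q^{-i-1}` (`prod_add_nodeVal`, which amounts to the `q`-Pfaff–Saalschütz sum) thus writes a
series with one pair more as a finite combination of series with `e / q^m` in place of `e`. As `φ`
is symmetric in `a` and `b`, the coefficients are the same for both one-sided series. Induction on
the number of pairs, carrying the accumulated shift `M = m_1 + ⋯ + m_s`, gives the multiple sum
(`regPairTerm_summable_and_eq`).
-/

open scoped BigOperators
open Filter Topology

noncomputable section

namespace RamanujanReciprocity

/-! ### Basic facts on `q`-shifted factorials -/

section Factorials

variable {q : ℂ}

@[simp] lemma qPoch_zero (q x : ℂ) : qPoch q x 0 = 1 := by simp [qPoch]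

lemma qPoch_succ (q x : ℂ) (n : ℕ) : qPoch q x (n + 1) = qPoch q x n * (1 - x * q ^ n) := by
  simp [qPoch, Finset.prod_range_succ]

lemma qPoch_add (q x : ℂ) (m n : ℕ) :
    qPoch q x (m + n) = qPoch q x m * qPoch q (x * q ^ m) n := by
  simp only [qPoch, Finset.prod_range_add, pow_add, mul_assoc]

lemma qPoch_ne_zero_of_le {x : ℂ} {m n : ℕ} (h : qPoch q x n ≠ 0) (hmn : m ≤ n) :
    qPoch q x m ≠ 0 := by
  obtain ⟨k, rfl⟩ := Nat.exists_eq_add_of_le hmn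
  rw [qPoch_add] at h
  exact left_ne_zero_of_mul h

lemma QNonvanishing.qPoch_ne_zero {x : ℂ} (h : QNonvanishing q x) (n : ℕ) : qPoch q x n ≠ 0 :=
  Finset.prod_ne_zero_iff.2 fun i _ => h i

lemma summable_norm_mul_pow (hq : ‖q‖ < 1) (x : ℂ) : Summable fun k : ℕ => ‖-(x * q ^ k)‖ := by
  simpa [norm_mul, norm_pow] using
    (summable_geometric_of_lt_one (norm_nonneg q) hq).mul_left ‖x‖

lemma multipliable_qPochInf (hq : ‖q‖ < 1) (x : ℂ) : Multipliable fun k : ℕ => 1 - x * q ^ k := by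
  simpa [sub_eq_add_neg] using multipliable_one_add_of_summable (summable_norm_mul_pow hq x)

lemma tendsto_qPoch (hq : ‖q‖ < 1) (x : ℂ) :
    Tendsto (qPoch q x) atTop (𝓝 (qPochInf q x)) :=
  (multipliable_qPochInf hq x).hasProd.tendsto_prod_nat

lemma qPochInf_eq_qPoch_mul (hq : ‖q‖ < 1) (x : ℂ) (n : ℕ) :
    qPochInf q x = qPoch q x n * qPochInf q (x * q ^ n) := by
  have h : Multipliable fun k : ℕ => 1 - x * q ^ (k + n) := by
    refine (multipliable_qPochInf hq (x * q ^ n)).congr fun k => ?_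
    rw [pow_add]; ring
  have h2 := Multipliable.prod_mul_tprod_nat_mul' (f := fun k : ℕ => 1 - x * q ^ k) h
  refine h2.symm.trans ?_
  unfold qPoch qPochInf
  congr 1
  refine tprod_congr fun k => ?_
  rw [pow_add]; ring

lemma qPochInf_eq_mul (hq : ‖q‖ < 1) (x : ℂ) :
    qPochInf q x = (1 - x) * qPochInf q (x * q) := by
  simpa [qPoch] using qPochInf_eq_qPoch_mul hq x 1

lemma QNonvanishing.qPochInf_ne_zero {x : ℂ} (hq : ‖q‖ < 1) (h : QNonvanishing q x) :
    qPochInf q x ≠ 0 := by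
  have := tprod_one_add_ne_zero_of_summable (f := fun k : ℕ => -(x * q ^ k))
    (fun i => by simpa only [← sub_eq_add_neg] using h i) (summable_norm_mul_pow hq x)
  simpa [qPochInf, sub_eq_add_neg] using this

lemma qNonvanishing_of_norm_lt_one {x : ℂ} (hq : ‖q‖ < 1) (hx : ‖x‖ < 1) : QNonvanishing q x := by
  intro k hk
  have h1 : ‖x * q ^ k‖ < 1 := by
    rw [norm_mul, norm_pow]
    calc ‖x‖ * ‖q‖ ^ k ≤ ‖x‖ * 1 := by
          gcongr; exact pow_le_one₀ (norm_nonneg _) hq.le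
      _ < 1 := by simpa
  rw [← sub_eq_zero.1 hk] at h1
  simp at h1

lemma qPochInf_zero (q : ℂ) : qPochInf q 0 = 1 := by simp [qPochInf]

lemma prod_one_add_mul_pow_le {r : ℝ} (hr0 : 0 ≤ r) (hr : r < 1) {R : ℝ} (hR : 0 ≤ R) (n : ℕ) :
    ∏ i ∈ Finset.range n, (1 + R * r ^ i) ≤ Real.exp (R * (1 - r)⁻¹) := by
  refine (Real.prod_one_add_le_exp_sum _ fun i => by positivity).trans (Real.exp_le_exp.2 ?_)
  rw [← Finset.mul_sum, ← tsum_geometric_of_lt_one hr0 hr]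
  gcongr
  exact (summable_geometric_of_lt_one hr0 hr).sum_le_tsum _ fun i _ => by positivity

lemma norm_qPoch_sub_one_le (hq : ‖q‖ < 1) (x : ℂ) (n : ℕ) :
    ‖qPoch q x n - 1‖ ≤ Real.exp (‖x‖ * (1 - ‖q‖)⁻¹) - 1 := by
  have h := Finset.norm_prod_one_add_sub_one_le (Finset.range n) fun k : ℕ => -(x * q ^ k)
  simp only [← sub_eq_add_neg] at h
  refine h.trans (sub_le_sub_right (Real.exp_le_exp.2 ?_) _)
  simp only [norm_neg, norm_mul, norm_pow]
  rw [← Finset.mul_sum, ← tsum_geometric_of_lt_one (norm_nonneg q) hq]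
  gcongr
  exact (summable_geometric_of_lt_one (norm_nonneg q) hq).sum_le_tsum _ fun i _ => by positivity

lemma norm_qPochInf_sub_one_le (hq : ‖q‖ < 1) (x : ℂ) :
    ‖qPochInf q x - 1‖ ≤ Real.exp (‖x‖ * (1 - ‖q‖)⁻¹) - 1 :=
  le_of_tendsto ((tendsto_qPoch hq x).sub_const 1).norm
    (Eventually.of_forall (norm_qPoch_sub_one_le hq x))

lemma norm_qPochInf_le (hq : ‖q‖ < 1) {x : ℂ} {R : ℝ} (hx : ‖x‖ ≤ R) :
    ‖qPochInf q x‖ ≤ Real.exp (R * (1 - ‖q‖)⁻¹) := by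
  have h1 := norm_qPochInf_sub_one_le hq x
  have h2 : ‖qPochInf q x‖ ≤ ‖qPochInf q x - 1‖ + 1 := by
    simpa using norm_add_le (qPochInf q x - 1) 1
  have h3 : Real.exp (‖x‖ * (1 - ‖q‖)⁻¹) ≤ Real.exp (R * (1 - ‖q‖)⁻¹) := by
    have : 0 ≤ (1 - ‖q‖)⁻¹ := inv_nonneg.2 (by linarith)
    gcongr
  linarith

lemma tendsto_qPochInf_one {ι : Type*} {l : Filter ι} (hq : ‖q‖ < 1) {u : ι → ℂ}
    (hu : Tendsto u l (𝓝 0)) : Tendsto (fun i => qPochInf q (u i)) l (𝓝 1) := by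
  rw [tendsto_iff_norm_sub_tendsto_zero]
  refine squeeze_zero (fun _ => norm_nonneg _) (fun i => norm_qPochInf_sub_one_le hq (u i)) ?_
  have h : Tendsto (fun i => Real.exp (‖u i‖ * (1 - ‖q‖)⁻¹) - 1) l
      (𝓝 (Real.exp (0 * (1 - ‖q‖)⁻¹) - 1)) :=
    ((Real.continuous_exp.tendsto _).comp
      ((tendsto_zero_iff_norm_tendsto_zero.1 hu).mul_const _)).sub_const 1
  simpa using h

lemma tendsto_pow_zero (hq : ‖q‖ < 1) : Tendsto (fun n : ℕ => q ^ n) atTop (𝓝 0) :=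
  tendsto_pow_atTop_nhds_zero_of_norm_lt_one hq

/-- Quotients of `q`-shifted factorials are bounded: numerator and denominator converge, the
latter to a nonzero limit. -/
lemma exists_norm_qPoch_div_le (hq : ‖q‖ < 1) (x : ℂ) {y : ℂ} (hy : QNonvanishing q y) :
    ∃ K : ℝ, 0 ≤ K ∧ ∀ k, ‖qPoch q x (k + 1) / qPoch q y k‖ ≤ K := by
  have h : Tendsto (fun k => qPoch q x (k + 1) / qPoch q y k) atTop
      (𝓝 (qPochInf q x / qPochInf q y)) :=
    ((tendsto_qPoch hq x).comp (tendsto_add_atTop_nat 1)).div (tendsto_qPoch hq y)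
      (hy.qPochInf_ne_zero hq)
  obtain ⟨K, hK⟩ := (Metric.isBounded_range_of_tendsto _ h).exists_norm_le
  exact ⟨K, (norm_nonneg _).trans (hK _ ⟨0, rfl⟩), fun k => hK _ ⟨k, rfl⟩⟩

end Factorials

/-! ### The regularized series without pairs -/

/-- The product `∏_{i < k} (f + a q^{i+1})`, i.e. `f ^ k (-qa/f; q)_k` when `f ≠ 0`. -/
def shiftProd (q a f : ℂ) (k : ℕ) : ℂ := ∏ i ∈ Finset.range k, (f + a * q ^ (i + 1))

/-- The factor contributed by a parameter `f` to the `k`-th term of `ρ(a, b; …)`, multiplied by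
`(-f/a, -f/b; q)_∞`. It has no denominator in `f`, hence makes sense for every `f`,
including `0`. -/
def regFactor (q a b f : ℂ) (k : ℕ) : ℂ :=
  shiftProd q a f k * qPochInf q (-(f * q ^ (k + 1) / b)) * qPochInf q (-(f / a))

/-- The part of the `k`-th term of `ρ(a, b; …)` that does not depend on the other parameters. -/
def baseFactor (q a b : ℂ) (k : ℕ) : ℂ :=
  (1 - a * q ^ (2 * k + 1) / b) * (qPoch q (-1 / b) (k + 1) / qPoch q (-(q * a)) k)

/-- The `k`-th term of `ρ(a, b; c, d, e)`, multiplied by `(-f/a, -f/b; q)_∞` for each of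
`f = c, d, e`. -/
def regTerm (q a b c d e : ℂ) (k : ℕ) : ℂ :=
  baseFactor q a b k * (regFactor q a b c k * regFactor q a b d k * regFactor q a b e k)
    * (1 / (q * a * b)) ^ k

/-- The difference of the two regularized series. -/
def regSum (q a b c d e : ℂ) : ℂ := ∑' k, regTerm q a b c d e k - ∑' k, regTerm q b a c d e k

section Bounds

variable {q a b : ℂ}

lemma shiftProd_succ (q a f : ℂ) (k : ℕ) :
    shiftProd q a f (k + 1) = shiftProd q a f k * (f + a * q ^ (k + 1)) := by
  simp [shiftProd, Finset.prod_range_succ]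

@[simp] lemma shiftProd_zero (q a f : ℂ) : shiftProd q a f 0 = 1 := by simp [shiftProd]

lemma norm_shiftProd_le (hq : ‖q‖ < 1) (a : ℂ) {f : ℂ} {F : ℝ} (hF : 0 < F) (hf : ‖f‖ ≤ F)
    (k : ℕ) : ‖shiftProd q a f k‖ ≤ Real.exp (‖a‖ / F * (1 - ‖q‖)⁻¹) * F ^ k := by
  have h1 : ‖shiftProd q a f k‖ ≤ ∏ i ∈ Finset.range k, (F * (1 + ‖a‖ / F * ‖q‖ ^ i)) := by
    rw [shiftProd, norm_prod]
    refine Finset.prod_le_prod (fun _ _ => norm_nonneg _) fun i _ => ?_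
    have h2 : ‖q‖ ^ (i + 1) ≤ ‖q‖ ^ i := pow_le_pow_of_le_one (norm_nonneg _) hq.le (by omega)
    calc ‖f + a * q ^ (i + 1)‖ ≤ ‖f‖ + ‖a‖ * ‖q‖ ^ (i + 1) := by
          refine (norm_add_le _ _).trans_eq ?_
          rw [norm_mul, norm_pow]
      _ ≤ F + ‖a‖ * ‖q‖ ^ i := by gcongr
      _ = F * (1 + ‖a‖ / F * ‖q‖ ^ i) := by field_simp
  refine h1.trans ?_
  rw [Finset.prod_mul_distrib, Finset.prod_const, Finset.card_range, mul_comm]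
  gcongr
  exact prod_one_add_mul_pow_le (norm_nonneg q) hq (by positivity) k

lemma norm_qPochInf_neg_le (hq : ‖q‖ < 1) (b : ℂ) {f : ℂ} {F : ℝ} (hf : ‖f‖ ≤ F) (j : ℕ) :
    ‖qPochInf q (-(f * q ^ j / b))‖ ≤ Real.exp (F / ‖b‖ * (1 - ‖q‖)⁻¹) := by
  refine norm_qPochInf_le hq ?_
  rw [norm_neg, norm_div, norm_mul, norm_pow]
  gcongr
  have h : ‖q‖ ^ j ≤ 1 := pow_le_one₀ (norm_nonneg _) hq.le
  nlinarith [norm_nonneg f]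

/-- Factors of the shape occurring in the series and in the telescoping sequences are
`O(F ^ k)`, uniformly in the parameter `f` with `‖f‖ ≤ F`. -/
lemma exists_norm_factor_le (hq : ‖q‖ < 1) (a a' b : ℂ) {F : ℝ} (hF : 0 < F) :
    ∃ K : ℝ, 0 ≤ K ∧ ∀ (f : ℂ) (k i j : ℕ), ‖f‖ ≤ F →
      ‖shiftProd q a' f k * qPochInf q (-(f * q ^ i / b)) * qPochInf q (-(f * q ^ j / a))‖
        ≤ K * F ^ k := by
  refine ⟨Real.exp (‖a'‖ / F * (1 - ‖q‖)⁻¹) * Real.exp (F / ‖b‖ * (1 - ‖q‖)⁻¹)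
    * Real.exp (F / ‖a‖ * (1 - ‖q‖)⁻¹), by positivity, fun f k i j hf => ?_⟩
  rw [norm_mul, norm_mul]
  have h1 := norm_shiftProd_le hq a' hF hf k
  have h2 := norm_qPochInf_neg_le hq b hf i
  have h3 := norm_qPochInf_neg_le hq a hf j
  calc _ ≤ (Real.exp (‖a'‖ / F * (1 - ‖q‖)⁻¹) * F ^ k) * Real.exp (F / ‖b‖ * (1 - ‖q‖)⁻¹)
        * Real.exp (F / ‖a‖ * (1 - ‖q‖)⁻¹) := by gcongr
    _ = _ := by ring

lemma exists_norm_regFactor_le (hq : ‖q‖ < 1) (a b : ℂ) {F : ℝ} (hF : 0 < F) :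
    ∃ K : ℝ, 0 ≤ K ∧ ∀ (f : ℂ) (k : ℕ), ‖f‖ ≤ F → ‖regFactor q a b f k‖ ≤ K * F ^ k := by
  obtain ⟨K, hK, h⟩ := exists_norm_factor_le hq a a b hF
  exact ⟨K, hK, fun f k hf => by simpa [regFactor] using h f k (k + 1) 0 hf⟩

lemma exists_norm_baseFactor_le (hq : ‖q‖ < 1) (b : ℂ) (hqa : QNonvanishing q (-(q * a))) :
    ∃ K : ℝ, 0 ≤ K ∧ ∀ k, ‖baseFactor q a b k‖ ≤ K := by
  obtain ⟨K, hK, h⟩ := exists_norm_qPoch_div_le hq (-1 / b) hqa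
  refine ⟨(1 + ‖a‖ / ‖b‖) * K, by positivity, fun k => ?_⟩
  rw [baseFactor, norm_mul]
  have h1 : ‖q‖ ^ (2 * k + 1) ≤ 1 := pow_le_one₀ (norm_nonneg _) hq.le
  have h2 : ‖1 - a * q ^ (2 * k + 1) / b‖ ≤ 1 + ‖a‖ / ‖b‖ := by
    refine (norm_sub_le _ _).trans ?_
    rw [norm_one, norm_div, norm_mul, norm_pow]
    gcongr
    nlinarith [norm_nonneg a]
  gcongr
  exact h k

lemma exists_norm_regTerm_le (hq : ‖q‖ < 1) (b : ℂ) (hqa : QNonvanishing q (-(q * a)))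
    {C D E : ℝ} (hC : 0 < C) (hD : 0 < D) (hE : 0 < E) :
    ∃ K : ℝ, ∀ (c d e : ℂ) (k : ℕ), ‖c‖ ≤ C → ‖d‖ ≤ D → ‖e‖ ≤ E →
      ‖regTerm q a b c d e k‖ ≤ K * (C * D * E / ‖q * a * b‖) ^ k := by
  obtain ⟨K0, hK0, h0⟩ := exists_norm_baseFactor_le hq b hqa
  obtain ⟨K1, hK1, h1⟩ := exists_norm_regFactor_le hq a b hC
  obtain ⟨K2, hK2, h2⟩ := exists_norm_regFactor_le hq a b hD
  obtain ⟨K3, hK3, h3⟩ := exists_norm_regFactor_le hq a b hE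
  refine ⟨K0 * (K1 * K2 * K3), fun c d e k hc hd he => ?_⟩
  rw [regTerm, norm_mul, norm_mul, norm_mul, norm_mul, norm_pow, norm_div, norm_one]
  have := h0 k
  have := h1 c k hc
  have := h2 d k hd
  have := h3 e k he
  calc _ ≤ K0 * ((K1 * C ^ k) * (K2 * D ^ k) * (K3 * E ^ k)) * (1 / ‖q * a * b‖) ^ k := by gcongr
    _ = _ := by rw [div_pow, div_pow, mul_pow, mul_pow, one_pow]; ring

/-- Positive bounds on `c, d, e` with which the convergence condition still holds. -/
lemma exists_bounds {A : ℝ} {c d e : ℂ} (h : ‖c * d * e‖ < A) :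
    ∃ C D E : ℝ, ‖c‖ < C ∧ ‖d‖ < D ∧ ‖e‖ < E ∧ C * D * E < A := by
  have h1 : Tendsto (fun t : ℝ => (‖c‖ + t) * (‖d‖ + t) * (‖e‖ + t)) (𝓝[>] 0)
      (𝓝 ((‖c‖ + 0) * (‖d‖ + 0) * (‖e‖ + 0))) := by
    have : Continuous fun t : ℝ => (‖c‖ + t) * (‖d‖ + t) * (‖e‖ + t) := by fun_prop
    exact (this.tendsto 0).mono_left nhdsWithin_le_nhds
  have h2 : (‖c‖ + 0) * (‖d‖ + 0) * (‖e‖ + 0) < A := by simpa [norm_mul] using h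
  obtain ⟨t, ht, ht0⟩ := ((h1.eventually_lt_const h2).and self_mem_nhdsWithin).exists
  have ht0 : 0 < t := ht0
  exact ⟨_, _, _, by linarith, by linarith, by linarith, ht⟩

end Bounds

section Sum

variable {q a b c d e : ℂ}

lemma summable_regTerm (hq : ‖q‖ < 1) (hqa : QNonvanishing q (-(q * a)))
    (h : ‖c * d * e‖ < ‖q * a * b‖) : Summable (regTerm q a b c d e) := by
  have hA : 0 < ‖q * a * b‖ := (norm_nonneg _).trans_lt h
  obtain ⟨C, D, E, hC, hD, hE, hCDE⟩ := exists_bounds h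
  have hC0 := (norm_nonneg _).trans_lt hC
  have hD0 := (norm_nonneg _).trans_lt hD
  have hE0 := (norm_nonneg _).trans_lt hE
  obtain ⟨K, hK⟩ := exists_norm_regTerm_le hq b hqa hC0 hD0 hE0
  exact ((summable_geometric_of_lt_one (by positivity) ((div_lt_one hA).2 hCDE)).mul_left
    K).of_norm_bounded fun k => hK c d e k hC.le hD.le hE.le

lemma tendsto_regFactor (hq : ‖q‖ < 1) (f : ℂ) (k : ℕ) :
    Tendsto (fun m : ℕ => regFactor q a b (f * q ^ m) k) atTop (𝓝 (regFactor q a b 0 k)) := by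
  have hp : Tendsto (fun m : ℕ => f * q ^ m) atTop (𝓝 0) := by
    simpa using (tendsto_pow_zero hq).const_mul f
  have h1 : Continuous fun f : ℂ => shiftProd q a f k := by unfold shiftProd; fun_prop
  have h2 : Tendsto (fun m : ℕ => -(f * q ^ m * q ^ (k + 1) / b)) atTop (𝓝 0) := by
    simpa using ((hp.mul_const (q ^ (k + 1))).div_const b).neg
  have h3 : Tendsto (fun m : ℕ => -(f * q ^ m / a)) atTop (𝓝 0) := by
    simpa using (hp.div_const a).neg
  have := (((h1.tendsto 0).comp hp).mul (tendsto_qPochInf_one hq h2)).mul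
    (tendsto_qPochInf_one hq h3)
  simpa [regFactor, qPochInf_zero] using this

lemma tendsto_tsum_regTerm (hq : ‖q‖ < 1) (hqa : QNonvanishing q (-(q * a)))
    (h : ‖c * d * e‖ < ‖q * a * b‖) :
    Tendsto (fun m : ℕ => ∑' k, regTerm q a b (c * q ^ m) d e k) atTop
      (𝓝 (∑' k, regTerm q a b 0 d e k)) := by
  have hA : 0 < ‖q * a * b‖ := (norm_nonneg _).trans_lt h
  obtain ⟨C, D, E, hC, hD, hE, hCDE⟩ := exists_bounds h
  have hC0 := (norm_nonneg _).trans_lt hC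
  have hD0 := (norm_nonneg _).trans_lt hD
  have hE0 := (norm_nonneg _).trans_lt hE
  obtain ⟨K, hK⟩ := exists_norm_regTerm_le hq b hqa hC0 hD0 hE0
  refine tendsto_tsum_of_dominated_convergence
    ((summable_geometric_of_lt_one (by positivity) ((div_lt_one hA).2 hCDE)).mul_left K)
    (fun k => ?_) (Eventually.of_forall fun m k => hK _ d e k ?_ hD.le hE.le)
  · exact (((((tendsto_regFactor hq c k).mul_const _).mul_const _).const_mul _).mul_const _)
  · rw [norm_mul, norm_pow]
    have : ‖q‖ ^ m ≤ 1 := pow_le_one₀ (norm_nonneg _) hq.le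
    nlinarith [norm_nonneg c]

lemma tendsto_regSum (hq : ‖q‖ < 1) (hqa : QNonvanishing q (-(q * a)))
    (hqb : QNonvanishing q (-(q * b))) (h : ‖c * d * e‖ < ‖q * a * b‖) :
    Tendsto (fun m : ℕ => regSum q a b (c * q ^ m) d e) atTop (𝓝 (regSum q a b 0 d e)) :=
  (tendsto_tsum_regTerm hq hqa h).sub
    (tendsto_tsum_regTerm hq hqb (by rwa [mul_right_comm q b a]))

lemma regTerm_swap (q a b c d e : ℂ) : regTerm q a b c d e = regTerm q a b d c e := by
  ext k; unfold regTerm; ring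

lemma regTerm_rotate (q a b c d e : ℂ) : regTerm q a b c d e = regTerm q a b d e c := by
  ext k; unfold regTerm; ring

lemma regSum_rotate (q a b c d e : ℂ) : regSum q a b c d e = regSum q a b d e c := by
  simp only [regSum, regTerm_rotate q _ _ c d e]

/-- The sequence whose differences give the contiguous relation for `regTerm` under `c ↦ c q`. -/
def teleTerm (q a b c d e : ℂ) (k : ℕ) : ℂ :=
  -(c / a) * ((qPoch q (-1 / b) (k + 1) / qPoch q (-(q * a)) k) * (1 + a * q ^ k))
    * (shiftProd q (a / q) c k * qPochInf q (-(c * q ^ (k + 1) / b))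
        * qPochInf q (-(c * q ^ 1 / a)))
    * (shiftProd q a d k * qPochInf q (-(d * q ^ k / b)) * qPochInf q (-(d * q ^ 0 / a)))
    * (shiftProd q a e k * qPochInf q (-(e * q ^ k / b)) * qPochInf q (-(e * q ^ 0 / a)))
    * (1 / (q * a * b)) ^ k

lemma tendsto_teleTerm (hq : ‖q‖ < 1) (hqa : QNonvanishing q (-(q * a)))
    (h : ‖c * d * e‖ < ‖q * a * b‖) : Tendsto (teleTerm q a b c d e) atTop (𝓝 0) := by
  have hA : 0 < ‖q * a * b‖ := (norm_nonneg _).trans_lt h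
  obtain ⟨C, D, E, hC, hD, hE, hCDE⟩ := exists_bounds h
  have hC0 := (norm_nonneg _).trans_lt hC
  have hD0 := (norm_nonneg _).trans_lt hD
  have hE0 := (norm_nonneg _).trans_lt hE
  obtain ⟨K0, hK0, h0⟩ := exists_norm_qPoch_div_le hq (-1 / b) hqa
  obtain ⟨K1, hK1, h1⟩ := exists_norm_factor_le hq a (a / q) b hC0
  obtain ⟨K2, hK2, h2⟩ := exists_norm_factor_le hq a a b hD0
  obtain ⟨K3, hK3, h3⟩ := exists_norm_factor_le hq a a b hE0
  refine squeeze_zero_norm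
    (a := fun k => ‖c / a‖ * (K0 * (1 + ‖a‖)) * K1 * K2 * K3 * (C * D * E / ‖q * a * b‖) ^ k)
    (fun k => ?_) ?_
  · simp only [teleTerm]
    rw [norm_mul, norm_mul, norm_mul, norm_mul, norm_mul, norm_mul, norm_neg, norm_pow, norm_div 1,
      norm_one]
    have h4 : ‖1 + a * q ^ k‖ ≤ 1 + ‖a‖ := by
      refine (norm_add_le _ _).trans ?_
      rw [norm_one, norm_mul, norm_pow]
      have : ‖q‖ ^ k ≤ 1 := pow_le_one₀ (norm_nonneg _) hq.le
      nlinarith [norm_nonneg a]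
    have := h0 k
    have := h1 c k (k + 1) 1 hC.le
    have := h2 d k k 0 hD.le
    have := h3 e k k 0 hE.le
    calc _ ≤ ‖c / a‖ * (K0 * (1 + ‖a‖)) * (K1 * C ^ k) * (K2 * D ^ k) * (K3 * E ^ k)
          * (1 / ‖q * a * b‖) ^ k := by gcongr
      _ = _ := by rw [div_pow, div_pow, mul_pow, mul_pow, one_pow]; ring
  · simpa using (tendsto_pow_atTop_nhds_zero_of_lt_one (by positivity)
      ((div_lt_one hA).2 hCDE)).const_mul _

lemma shiftProd_div_succ (hq0 : q ≠ 0) (a c : ℂ) (n : ℕ) :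
    shiftProd q (a / q) c (n + 1) = shiftProd q (a / q) c n * (c + a * q ^ n) := by
  rw [shiftProd_succ, pow_succ]; field_simp

lemma qPochInf_neg_eq_mul (hq : ‖q‖ < 1) (b f : ℂ) (n : ℕ) :
    qPochInf q (-(f * q ^ n / b)) = (1 + f * q ^ n / b) * qPochInf q (-(f * q ^ (n + 1) / b)) := by
  rw [qPochInf_eq_mul hq]; congr 1 <;> ring_nf

/-- `regFactor` at `c`, written so that it shares all factors but an elementary one with its
value at `c q`, see `regFactor_mul_eq`. -/
lemma regFactor_eq (hq0 : q ≠ 0) (hq : ‖q‖ < 1) (ha : a ≠ 0) (c : ℂ) (k : ℕ) :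
    regFactor q a b c k = shiftProd q (a / q) c k * (c + a * q ^ k) / a
      * ((1 + c * q ^ (k + 1) / b) * qPochInf q (-(c * q ^ (k + 1 + 1) / b)))
      * qPochInf q (-(c * q ^ 1 / a)) := by
  have hs1 : ∀ n, shiftProd q a c n * (1 + c / a) = shiftProd q (a / q) c (n + 1) / a := by
    intro n
    induction n with
    | zero => simp [shiftProd]; field_simp; ring
    | succ n ih =>
      rw [shiftProd_succ, mul_right_comm, ih, shiftProd_div_succ hq0 a c (n + 1)]; ring
  have e1 := qPochInf_neg_eq_mul hq a c 0
  rw [pow_zero, mul_one, zero_add] at e1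
  rw [regFactor, e1, qPochInf_neg_eq_mul hq b c (k + 1), ← shiftProd_div_succ hq0, ← hs1]; ring

lemma regFactor_mul_eq (q : ℂ) (hq0 : q ≠ 0) (a b c : ℂ) (k : ℕ) :
    regFactor q a b (c * q) k = q ^ k * shiftProd q (a / q) c k
      * qPochInf q (-(c * q ^ (k + 1 + 1) / b)) * qPochInf q (-(c * q ^ 1 / a)) := by
  have hs2 : ∀ n, shiftProd q a (c * q) n = q ^ n * shiftProd q (a / q) c n := by
    intro n
    induction n with
    | zero => simp [shiftProd]
    | succ n ih => rw [shiftProd_succ, ih, shiftProd_div_succ hq0]; ring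
  rw [regFactor, hs2]
  congr 3 <;> ring

/-- The rational identity behind the contiguous relation, with `X = q ^ k`. -/
lemma contiguous_aux (hq0 : q ≠ 0) (ha : a ≠ 0) (hb : b ≠ 0) (c d e X : ℂ) :
    (1 - a * (X ^ 2 * q) / b) * ((1 - c * d * e / (q * a * b)) * ((c + a * X) / a
          * (1 + c * (X * q) / b))
        - (1 - c) * (1 - c * d / (a * b)) * (1 - c * e / (a * b)) * X)
      = -(c / a) * ((1 + X * q / b) * (c + a * X) * (d + a * (X * q)) * (e + a * (X * q))
            * (1 / (q * a * b))
          - (1 + a * X) * (1 + c * (X * q) / b) * (1 + d * X / b) * (1 + e * X / b)) := by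
  field_simp
  ring

lemma regTerm_contiguous (hq0 : q ≠ 0) (hq : ‖q‖ < 1) (ha : a ≠ 0) (hb : b ≠ 0)
    (hqa : QNonvanishing q (-(q * a))) (c d e : ℂ) (k : ℕ) :
    (1 - c * d * e / (q * a * b)) * regTerm q a b c d e k
        - (1 - c) * (1 - c * d / (a * b)) * (1 - c * e / (a * b)) * regTerm q a b (c * q) d e k
      = teleTerm q a b c d e (k + 1) - teleTerm q a b c d e k := by
  have hP : qPoch q (-(q * a)) k ≠ 0 := hqa.qPoch_ne_zero k
  have hP' : 1 + a * q ^ k * q ≠ 0 := by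
    have := hqa k
    intro h0; apply this; linear_combination h0
  have e2 := fun f n => qPochInf_neg_eq_mul hq b f n
  have r1 := regFactor_eq (b := b) hq0 hq ha c k
  have r2 := regFactor_mul_eq q hq0 a b c k
  simp only [regTerm, teleTerm, r1, r2, baseFactor]
  simp only [regFactor]
  rw [shiftProd_div_succ hq0, shiftProd_succ q a d, shiftProd_succ q a e, qPoch_succ q _ (k + 1),
    qPoch_succ q (-(q * a)), e2 d k, e2 e k, e2 c (k + 1)]
  have hx : 1 - -(q * a) * q ^ k = 1 + a * q ^ k * q := by ring
  rw [hx, pow_zero, mul_one, mul_one]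
  generalize shiftProd q (a / q) c k = H1
  generalize shiftProd q a d k = H2
  generalize shiftProd q a e k = H3
  generalize qPochInf q (-(c * q ^ (k + 1 + 1) / b)) = Z1
  generalize qPochInf q (-(d * q ^ (k + 1) / b)) = Z2
  generalize qPochInf q (-(e * q ^ (k + 1) / b)) = Z3
  generalize qPochInf q (-(c * q ^ 1 / a)) = W1
  generalize qPochInf q (-(d / a)) = W2
  generalize qPochInf q (-(e / a)) = W3
  generalize qPoch q (-1 / b) (k + 1) = V1
  generalize qPoch q (-(q * a)) k = V2 at *
  have p1 : q ^ (2 * k + 1) = (q ^ k) ^ 2 * q := by ring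
  rw [p1, pow_succ (1 / (q * a * b)) k, pow_succ q k]
  generalize (1 / (q * a * b)) ^ k = Y
  generalize q ^ k = X at *
  have hV : V1 * (1 - -1 / b * (X * q)) / (V2 * (1 + a * X * q)) * (1 + a * (X * q))
      = V1 / V2 * (1 + X * q / b) := by
    rw [mul_assoc a X q] at hP' ⊢
    rw [div_mul_eq_mul_div, mul_div_mul_right _ _ hP']
    ring
  have key := contiguous_aux hq0 ha hb c d e X
  rw [hV]
  linear_combination (V1 / V2 * H1 * H2 * H3 * Z1 * Z2 * Z3 * W1 * W2 * W3 * Y) * key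

lemma regSum_contiguous (hq0 : q ≠ 0) (hq : ‖q‖ < 1) (ha : a ≠ 0) (hb : b ≠ 0)
    (hqa : QNonvanishing q (-(q * a))) (hqb : QNonvanishing q (-(q * b)))
    (h : ‖c * d * e‖ < ‖q * a * b‖) :
    (1 - c * d * e / (q * a * b)) * regSum q a b c d e
      = (1 - c) * (1 - c * d / (a * b)) * (1 - c * e / (a * b)) * regSum q a b (c * q) d e := by
  have key : ∀ {a b : ℂ}, a ≠ 0 → b ≠ 0 → QNonvanishing q (-(q * a)) →
      ‖c * d * e‖ < ‖q * a * b‖ →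
      (1 - c * d * e / (q * a * b)) * ∑' k, regTerm q a b c d e k
        - (1 - c) * (1 - c * d / (a * b)) * (1 - c * e / (a * b))
          * ∑' k, regTerm q a b (c * q) d e k = - teleTerm q a b c d e 0 := by
    intro a b ha hb hqa h
    have h' : ‖c * q * d * e‖ < ‖q * a * b‖ := by
      refine lt_of_le_of_lt ?_ h
      rw [show c * q * d * e = q * (c * d * e) by ring, norm_mul]
      nlinarith [norm_nonneg (c * d * e)]
    have s1 := (summable_regTerm hq hqa h).hasSum.mul_left (1 - c * d * e / (q * a * b))
    have s2 := (summable_regTerm hq hqa h').hasSum.mul_left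
      ((1 - c) * (1 - c * d / (a * b)) * (1 - c * e / (a * b)))
    have t1 := (s1.sub s2).tendsto_sum_nat
    simp only [regTerm_contiguous hq0 hq ha hb hqa, Finset.sum_range_sub] at t1
    have t2 := (tendsto_teleTerm hq hqa h).sub_const (teleTerm q a b c d e 0)
    rw [zero_sub] at t2
    exact tendsto_nhds_unique t1 t2
  have k1 := key ha hb hqa h
  have k2 := key hb ha hqb (by rwa [mul_right_comm q b a])
  -- the boundary terms of the two series agree
  have k3 : teleTerm q a b c d e 0 = teleTerm q b a c d e 0 := by
    simp only [teleTerm, qPoch, Finset.prod_range_succ, Finset.prod_range_zero, shiftProd_zero]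
    simp only [pow_zero, zero_add]
    field_simp
    ring
  rw [mul_right_comm q b a, mul_comm b a] at k2
  unfold regSum
  linear_combination k1 - k2 - k3

end Sum

/-! ### Evaluation of the regularized series -/

section Evaluation

variable {q a b c d e : ℂ}

lemma regSum_eq_mul_regSum_zero (hq0 : q ≠ 0) (hq : ‖q‖ < 1) (ha : a ≠ 0) (hb : b ≠ 0)
    (hqa : QNonvanishing q (-(q * a))) (hqb : QNonvanishing q (-(q * b)))
    (h : ‖c * d * e‖ < ‖q * a * b‖) :
    qPochInf q (c * d * e / (q * a * b)) * regSum q a b c d e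
      = qPochInf q c * qPochInf q (c * d / (a * b)) * qPochInf q (c * e / (a * b))
        * regSum q a b 0 d e := by
  have hn : ∀ n : ℕ, qPoch q (c * d * e / (q * a * b)) n * regSum q a b c d e
      = qPoch q c n * qPoch q (c * d / (a * b)) n * qPoch q (c * e / (a * b)) n
        * regSum q a b (c * q ^ n) d e := by
    intro n
    induction n with
    | zero => simp
    | succ n ih =>
      have h' : ‖c * q ^ n * d * e‖ < ‖q * a * b‖ := by
        refine lt_of_le_of_lt ?_ h
        rw [show c * q ^ n * d * e = q ^ n * (c * d * e) by ring, norm_mul, norm_pow]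
        have : ‖q‖ ^ n ≤ 1 := pow_le_one₀ (norm_nonneg _) hq.le
        nlinarith [norm_nonneg (c * d * e)]
      have hc := regSum_contiguous hq0 hq ha hb hqa hqb h'
      rw [mul_assoc c (q ^ n) q, ← pow_succ] at hc
      simp only [qPoch_succ]
      linear_combination (1 - c * d * e / (q * a * b) * q ^ n) * ih
        + (qPoch q c n * qPoch q (c * d / (a * b)) n * qPoch q (c * e / (a * b)) n) * hc
  refine tendsto_nhds_unique ((tendsto_qPoch hq _).mul_const _) ?_
  simp only [hn]
  exact (((tendsto_qPoch hq _).mul (tendsto_qPoch hq _)).mul (tendsto_qPoch hq _)).mul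
    (tendsto_regSum hq hqa hqb h)

lemma regSum_eq_mul_regSum_zero_zero_zero (hq0 : q ≠ 0) (hq : ‖q‖ < 1) (ha : a ≠ 0) (hb : b ≠ 0)
    (hqa : QNonvanishing q (-(q * a))) (hqb : QNonvanishing q (-(q * b)))
    (h : ‖c * d * e‖ < ‖q * a * b‖) :
    qPochInf q (c * d * e / (q * a * b)) * regSum q a b c d e
      = qPochInf q c * qPochInf q d * qPochInf q e * qPochInf q (c * d / (a * b))
        * qPochInf q (c * e / (a * b)) * qPochInf q (d * e / (a * b)) * regSum q a b 0 0 0 := by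
  have h0 : 0 < ‖q * a * b‖ := (norm_nonneg _).trans_lt h
  have h1 := regSum_eq_mul_regSum_zero hq0 hq ha hb hqa hqb h
  have h2 := regSum_eq_mul_regSum_zero (c := d) (d := e) (e := 0) hq0 hq ha hb hqa hqb
    (by simpa using h0)
  have h3 := regSum_eq_mul_regSum_zero (c := e) (d := 0) (e := 0) hq0 hq ha hb hqa hqb
    (by simpa using h0)
  simp only [mul_zero, zero_div, qPochInf_zero, one_mul, mul_one] at h2 h3
  rw [h1, regSum_rotate q a b 0 d e, h2, regSum_rotate q a b 0 e 0, h3]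
  ring

lemma shiftProd_eq_zero (q a : ℂ) {k : ℕ} (hk : k ≠ 0) : shiftProd q a (-(q * a)) k = 0 :=
  Finset.prod_eq_zero (Finset.mem_range.2 (Nat.pos_of_ne_zero hk)) (by ring)

lemma regSum_neg_mul_neg_mul_zero (hq : ‖q‖ < 1) (ha : a ≠ 0) (hb : b ≠ 0) :
    regSum q a b (-(q * a)) (-(q * b)) 0
      = (1 / b - 1 / a) * qPochInf q q * qPochInf q (q * a / b) * qPochInf q (q * b / a)
        * qPochInf q (q * q) := by
  have key : ∀ {a b : ℂ}, a ≠ 0 → b ≠ 0 → ∑' k, regTerm q a b (-(q * a)) (-(q * b)) 0 k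
      = (1 + 1 / b) * qPochInf q q * qPochInf q (q * a / b) * qPochInf q (q * b / a)
        * qPochInf q (q * q) := by
    intro a b ha hb
    rw [tsum_eq_single 0 fun k hk => by simp [regTerm, regFactor, shiftProd_eq_zero q a hk]]
    have e1 : qPochInf q (q * a / b) = (1 - a * q / b) * qPochInf q (q * a * q / b) := by
      rw [qPochInf_eq_mul hq]; congr 1 <;> ring_nf
    have e2 : -(-(q * a) * q ^ (0 + 1) / b) = q * a * q / b := by ring
    have e3 : -(-(q * a) / a) = q := by field_simp
    have e4 : -(-(q * b) * q ^ (0 + 1) / b) = q * q := by field_simp; ring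
    have e5 : -(-(q * b) / a) = q * b / a := by ring
    simp only [regTerm, regFactor, baseFactor, e1, e2, e3, e4, e5]
    simp only [shiftProd_zero, qPoch_zero, qPoch_succ, zero_mul, zero_div, neg_zero, qPochInf_zero]
    ring
  have h2 := key hb ha
  rw [regTerm_swap] at h2
  rw [regSum, key ha hb, h2]
  ring

/-- The bilateral very-well-poised summation in regularized form. -/
theorem regSum_eq (hq0 : q ≠ 0) (hq : ‖q‖ < 1) (ha : a ≠ 0) (hb : b ≠ 0)
    (hqa : QNonvanishing q (-(q * a))) (hqb : QNonvanishing q (-(q * b)))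
    (h : ‖c * d * e‖ < ‖q * a * b‖) :
    qPochInf q (c * d * e / (q * a * b)) * regSum q a b c d e
      = (1 / b - 1 / a) * (qPochInf q q * qPochInf q (q * a / b) * qPochInf q (q * b / a))
        / (qPochInf q (-(q * a)) * qPochInf q (-(q * b)))
        * (qPochInf q c * qPochInf q d * qPochInf q e * qPochInf q (c * d / (a * b))
          * qPochInf q (c * e / (a * b)) * qPochInf q (d * e / (a * b))) := by
  have h0 : 0 < ‖q * a * b‖ := (norm_nonneg _).trans_lt h
  -- the choice `c = -qa`, `d = -qb`, `e = 0` leaves only the terms with `k = 0`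
  have h1 := regSum_eq_mul_regSum_zero_zero_zero (c := -(q * a)) (d := -(q * b)) (e := 0)
    hq0 hq ha hb hqa hqb (by simpa using h0)
  have e1 : -(q * a) * -(q * b) / (a * b) = q * q := by field_simp
  simp only [mul_zero, zero_div, qPochInf_zero, one_mul, mul_one, e1,
    regSum_neg_mul_neg_mul_zero hq ha hb] at h1
  have hqq : qPochInf q (q * q) ≠ 0 :=
    (qNonvanishing_of_norm_lt_one hq
      (by rw [norm_mul]; nlinarith [norm_nonneg q])).qPochInf_ne_zero hq
  have hA := hqa.qPochInf_ne_zero hq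
  have hB := hqb.qPochInf_ne_zero hq
  have h2 : regSum q a b 0 0 0 = (1 / b - 1 / a)
      * (qPochInf q q * qPochInf q (q * a / b) * qPochInf q (q * b / a))
        / (qPochInf q (-(q * a)) * qPochInf q (-(q * b))) := by
    rw [eq_div_iff (mul_ne_zero hA hB)]
    apply mul_right_cancel₀ hqq
    linear_combination -h1
  rw [regSum_eq_mul_regSum_zero_zero_zero hq0 hq ha hb hqa hqb h, h2]
  ring

end Evaluation

/-! ### Newton expansion of a product of linear factors -/

section Newton

variable {q a b x e : ℂ}

lemma prod_add_eq_sum_newton {K : ℕ → ℕ → ℂ} {t u : ℕ → ℂ} (h00 : K 0 0 = 1)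
    (hlt : ∀ N m, N < m → K N m = 0) (hz : ∀ N, K (N + 1) 0 = (t N - u 0) * K N 0)
    (hs : ∀ N m, K (N + 1) (m + 1) = K N m + (t N - u (m + 1)) * K N (m + 1)) (s : ℂ) (N : ℕ) :
    ∏ i ∈ Finset.range N, (s + t i)
      = ∑ m ∈ Finset.range (N + 1), K N m * ∏ i ∈ Finset.range m, (s + u i) := by
  induction N with
  | zero => simp [h00]
  | succ N ih =>
    rw [Finset.prod_range_succ, ih, Finset.sum_range_succ' _ (N + 1), hz]
    simp only [hs, add_mul, Finset.sum_add_distrib]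
    have h1 : ∑ m ∈ Finset.range (N + 1),
          (t N - u (m + 1)) * K N (m + 1) * ∏ i ∈ Finset.range (m + 1), (s + u i)
        + (t N - u 0) * K N 0 * ∏ i ∈ Finset.range 0, (s + u i)
        = ∑ m ∈ Finset.range (N + 1), (t N - u m) * K N m * ∏ i ∈ Finset.range m, (s + u i) := by
      rw [← Finset.sum_range_succ'
        (fun m => (t N - u m) * K N m * ∏ i ∈ Finset.range m, (s + u i)), Finset.sum_range_succ,
        hlt N (N + 1) (by omega)]
      ring
    rw [add_assoc, h1, ← Finset.sum_add_distrib, Finset.sum_mul]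
    refine Finset.sum_congr rfl fun m _ => ?_
    rw [Finset.prod_range_succ]
    ring

/-- The Gaussian binomial coefficient. -/
def gaussBinom (q : ℂ) (N m : ℕ) : ℂ :=
  (∏ i ∈ Finset.range m, (1 - q ^ (N - i))) / qPoch q q m

@[simp] lemma gaussBinom_zero (q : ℂ) (N : ℕ) : gaussBinom q N 0 = 1 := by simp [gaussBinom]

lemma gaussBinom_eq_zero (q : ℂ) {N m : ℕ} (h : N < m) : gaussBinom q N m = 0 := by
  rw [gaussBinom, Finset.prod_eq_zero (Finset.mem_range.2 h) (by simp), zero_div]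

lemma qPoch_self_ne_zero (hq : ‖q‖ < 1) (n : ℕ) : qPoch q q n ≠ 0 :=
  (qNonvanishing_of_norm_lt_one hq hq).qPoch_ne_zero n

lemma gaussBinom_succ_succ (hq : ‖q‖ < 1) (N m : ℕ) :
    gaussBinom q (N + 1) (m + 1) = gaussBinom q N m + q ^ (m + 1) * gaussBinom q N (m + 1) := by
  rcases lt_or_ge N m with h | h
  · rw [gaussBinom_eq_zero q h, gaussBinom_eq_zero q (show N + 1 < m + 1 by omega),
      gaussBinom_eq_zero q (show N < m + 1 by omega)]
    ring
  · have h1 := qPoch_self_ne_zero hq m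
    have h2 := qPoch_self_ne_zero hq (m + 1)
    have h3 : 1 - q * q ^ m ≠ 0 := by rw [qPoch_succ] at h2; exact right_ne_zero_of_mul h2
    rw [gaussBinom, gaussBinom, gaussBinom, Finset.prod_range_succ', Finset.prod_range_succ,
      qPoch_succ]
    simp only [Nat.add_sub_add_right, Nat.sub_zero]
    obtain ⟨L, rfl⟩ := Nat.exists_eq_add_of_le h
    rw [Nat.add_sub_cancel_left]
    field_simp
    ring

lemma gaussBinom_succ_succ' (hq : ‖q‖ < 1) (m L : ℕ) :
    gaussBinom q (m + L + 1) (m + 1)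
      = q ^ L * gaussBinom q (m + L) m + gaussBinom q (m + L) (m + 1) := by
  have h1 := qPoch_self_ne_zero hq m
  have h2 := qPoch_self_ne_zero hq (m + 1)
  have h3 : 1 - q * q ^ m ≠ 0 := by rw [qPoch_succ] at h2; exact right_ne_zero_of_mul h2
  rw [gaussBinom, gaussBinom, gaussBinom, Finset.prod_range_succ', Finset.prod_range_succ,
    qPoch_succ]
  simp only [Nat.add_sub_add_right, Nat.sub_zero]
  rw [Nat.add_sub_cancel_left]
  field_simp
  ring

lemma gaussBinom_self (hq : ‖q‖ < 1) (N : ℕ) : gaussBinom q N N = 1 := by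
  induction N with
  | zero => simp
  | succ N ih => rw [gaussBinom_succ_succ hq, ih, gaussBinom_eq_zero q (Nat.lt_succ_self N)]; simp

/-- The quantity `1 / v + q v / (ab)`: for a parameter `v`, the factor
`(1 + a q^k / v) (q^{-k} + q v / b)` is `a` times its sum with a term depending on `k` only. -/
def nodeVal (q a b v : ℂ) : ℂ := 1 / v + v * q / (a * b)

/-- The coefficients expanding `∏_{i < N} (s + nodeVal (x q^i))` in the products
`∏_{i < m} (s + nodeVal (e q^{-i-1}))`. -/
def newtonCoeff (q a b x e : ℂ) (N m : ℕ) : ℂ :=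
  gaussBinom q N m * (∏ i ∈ Finset.range (N - m), (x * q ^ i - e / q ^ (m + 1)))
    * ∏ i ∈ Finset.range (N - m), (q / (a * b) - q / (q ^ i * (x * e)))

lemma newtonCoeff_succ_succ (hq0 : q ≠ 0) (hq : ‖q‖ < 1) (ha : a ≠ 0) (hb : b ≠ 0) (hx : x ≠ 0)
    (he : e ≠ 0) (N m : ℕ) :
    newtonCoeff q a b x e (N + 1) (m + 1) = newtonCoeff q a b x e N m
      + (nodeVal q a b (x * q ^ N) - nodeVal q a b (e / q ^ (m + 1 + 1)))
        * newtonCoeff q a b x e N (m + 1) := by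
  rcases lt_trichotomy N m with h | rfl | h
  · simp [newtonCoeff, gaussBinom_eq_zero q h, gaussBinom_eq_zero q (show N + 1 < m + 1 by omega),
      gaussBinom_eq_zero q (show N < m + 1 by omega)]
  · simp [newtonCoeff, gaussBinom_self hq, gaussBinom_eq_zero q (Nat.lt_succ_self N)]
  · obtain ⟨L, rfl⟩ := Nat.exists_eq_add_of_lt h
    have hs : ∏ i ∈ Finset.range (L + 1), (x * q ^ i - e / q ^ (m + 1))
        = q ^ (L + 1) * (x / q - e / q ^ (m + 1 + 1))
          * ∏ i ∈ Finset.range L, (x * q ^ i - e / q ^ (m + 1 + 1)) := by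
      have : ∀ i, x * q ^ (i + 1) - e / q ^ (m + 1) = q * (x * q ^ i - e / q ^ (m + 1 + 1)) := by
        intro i; rw [pow_succ q (m + 1)]; field_simp; ring
      rw [Finset.prod_range_succ', Finset.prod_congr rfl fun i _ => this i,
        Finset.prod_mul_distrib, Finset.prod_const, Finset.card_range]
      generalize ∏ i ∈ Finset.range L, (x * q ^ i - e / q ^ (m + 1 + 1)) = D
      rw [pow_succ q (m + 1)]
      field_simp
      ring
    have hp1 := gaussBinom_succ_succ hq (m + L + 1) m
    have hp2 := gaussBinom_succ_succ' hq m (L + 1)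
    rw [← add_assoc] at hp2
    have hn : nodeVal q a b (x * q ^ (m + L + 1)) - nodeVal q a b (e / q ^ (m + 1 + 1))
        = (x * q ^ (m + L + 1) - e / q ^ (m + 1 + 1))
          * (q / (a * b) - q / (q ^ L * (x * e))) := by
      simp only [nodeVal, pow_add, pow_one]
      field_simp
      ring
    have e1 : m + L + 1 + 1 - (m + 1) = L + 1 := by omega
    have e2 : m + L + 1 - m = L + 1 := by omega
    have e3 : m + L + 1 - (m + 1) = L := by omega
    rw [hn]
    simp only [newtonCoeff, e1, e2, e3]
    rw [hs, Finset.prod_range_succ _ L, Finset.prod_range_succ _ L]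
    have key : gaussBinom q (m + L + 1 + 1) (m + 1) * (x * q ^ L - e / q ^ (m + 1 + 1))
        = gaussBinom q (m + L + 1) m * (q ^ (L + 1) * (x / q - e / q ^ (m + 1 + 1)))
          + (x * q ^ (m + L + 1) - e / q ^ (m + 1 + 1)) * gaussBinom q (m + L + 1) (m + 1) := by
      have e4 : q ^ (L + 1) * (x / q) = x * q ^ L := by rw [pow_succ]; field_simp
      rw [mul_sub (q ^ (L + 1)), e4]
      have e5 : q ^ (m + L + 1) = q ^ L * q ^ (m + 1) := by ring
      rw [e5]
      linear_combination (x * q ^ L) * hp1 - e / q ^ (m + 1 + 1) * hp2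
    linear_combination ((∏ i ∈ Finset.range L, (x * q ^ i - e / q ^ (m + 1 + 1)))
      * ((∏ i ∈ Finset.range L, (q / (a * b) - q / (q ^ i * (x * e))))
        * (q / (a * b) - q / (q ^ L * (x * e))))) * key

/-- A form of the `q`-Pfaff–Saalschütz summation. -/
theorem prod_add_nodeVal (hq0 : q ≠ 0) (hq : ‖q‖ < 1) (ha : a ≠ 0) (hb : b ≠ 0) (hx : x ≠ 0)
    (he : e ≠ 0) (s : ℂ) (N : ℕ) :
    ∏ i ∈ Finset.range N, (s + nodeVal q a b (x * q ^ i))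
      = ∑ m ∈ Finset.range (N + 1), newtonCoeff q a b x e N m
        * ∏ i ∈ Finset.range m, (s + nodeVal q a b (e / q ^ (i + 1))) := by
  refine prod_add_eq_sum_newton (K := newtonCoeff q a b x e)
    (t := fun i => nodeVal q a b (x * q ^ i)) (u := fun i => nodeVal q a b (e / q ^ (i + 1)))
    (by simp [newtonCoeff]) (fun N m h => by simp [newtonCoeff, gaussBinom_eq_zero q h])
    (fun N => ?_) (fun N m => newtonCoeff_succ_succ hq0 hq ha hb hx he N m) s N
  simp only [newtonCoeff, gaussBinom_zero, Nat.sub_zero, Finset.prod_range_succ, nodeVal, zero_add,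
    pow_one]
  have : 1 / (x * q ^ N) + x * q ^ N * q / (a * b) - (1 / (e / q) + e / q * q / (a * b))
      = (x * q ^ N - e / q) * (q / (a * b) - q / (q ^ N * (x * e))) := by
    field_simp
    ring
  rw [this]
  ring

end Newton

/-! ### Expansion of the factor contributed by a pair -/

section Pair

variable {q a b e x y : ℂ}

/-- The part of `(1 + a q^k / v) (q^{-k} + q v / b) / a` that depends on `k` only; the rest is
`nodeVal q a b v`. -/
def indexVal (q a b : ℂ) (k : ℕ) : ℂ := 1 / (a * q ^ k) + q ^ (k + 1) / b

lemma mul_indexVal_add_nodeVal (hq0 : q ≠ 0) (ha : a ≠ 0) (hb : b ≠ 0) {v : ℂ} (hv : v ≠ 0)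
    (k : ℕ) : a * (indexVal q a b k + nodeVal q a b v)
      = (1 + a * q ^ k / v) * (1 + v * q ^ (k + 1) / b) / q ^ k := by
  rw [indexVal, nodeVal, pow_succ]
  field_simp
  ring

lemma regFactor_eq_mul (hq0 : q ≠ 0) (hq : ‖q‖ < 1) (ha : a ≠ 0) (hb : b ≠ 0) {v : ℂ}
    (hv : v ≠ 0) (k : ℕ) : regFactor q a b v k
      = regFactor q a b (v * q) k * (v * (indexVal q a b k + nodeVal q a b v)) := by
  have h := mul_indexVal_add_nodeVal hq0 ha hb hv k
  have h2 : v * (indexVal q a b k + nodeVal q a b v)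
      = (v + a * q ^ k) * (1 + v * q ^ (k + 1) / b) / (a * q ^ k) := by
    have h3 : v * (indexVal q a b k + nodeVal q a b v)
        = v / a * (a * (indexVal q a b k + nodeVal q a b v)) := by field_simp
    rw [h3, h]
    field_simp
  rw [h2, regFactor_eq hq0 hq ha, regFactor_mul_eq q hq0]
  field_simp

/-- Dividing a parameter by `q^m` multiplies its factor by a product of `m` linear factors in
`indexVal`. -/
lemma regFactor_div_pow (hq0 : q ≠ 0) (hq : ‖q‖ < 1) (ha : a ≠ 0) (hb : b ≠ 0) (he : e ≠ 0)
    (m k : ℕ) : regFactor q a b (e / q ^ m) k = regFactor q a b e k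
      * ∏ i ∈ Finset.range m, (e / q ^ (i + 1)
        * (indexVal q a b k + nodeVal q a b (e / q ^ (i + 1)))) := by
  induction m with
  | zero => simp
  | succ m ih =>
    have h1 : e / q ^ (m + 1) * q = e / q ^ m := by rw [pow_succ]; field_simp
    rw [Finset.prod_range_succ, ← mul_assoc, ← ih,
      regFactor_eq_mul hq0 hq ha hb (v := e / q ^ (m + 1)) (by positivity), h1]

/-- The power `q ^ (n (n + 1) / 2)`. -/
def triPow (q : ℂ) (n : ℕ) : ℂ := ∏ i ∈ Finset.range n, q ^ (i + 1)

lemma triPow_succ (q : ℂ) (n : ℕ) : triPow q (n + 1) = triPow q n * q ^ (n + 1) := by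
  simp [triPow, Finset.prod_range_succ]

lemma triPow_ne_zero (hq0 : q ≠ 0) (n : ℕ) : triPow q n ≠ 0 :=
  Finset.prod_ne_zero_iff.2 fun _ _ => pow_ne_zero _ hq0

lemma triPow_add (q : ℂ) (m n : ℕ) : triPow q (m + n) = triPow q m * triPow q n * q ^ (m * n) := by
  induction n with
  | zero => simp [triPow]
  | succ n ih => rw [← add_assoc, triPow_succ, ih, triPow_succ]; ring

lemma triPow_sq (q : ℂ) (n : ℕ) : triPow q n ^ 2 = q ^ (n * (n + 1)) := by
  induction n with
  | zero => simp [triPow]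
  | succ n ih => rw [triPow_succ, mul_pow, ih]; ring

/-- The factor contributed by the pair `(x, y)` to the `k`-th term of `ρ(a, b; …)`, including its
shares of the prefactor `1 / b ^ n` and of the `k`-th power. -/
def pairTerm (q a b x y : ℂ) (N k : ℕ) : ℂ :=
  1 / b * ((qPoch q (-(q * a / x)) k * qPoch q (-(q * a / y)) k)
    / (qPoch q (-(x / b)) (k + 1) * qPoch q (-(y / b)) (k + 1))) * (1 / q ^ N) ^ k

/-- The quotient of `pairTerm` by a product of `N` linear factors in `indexVal`; it is symmetric in
`a` and `b`. -/
def pairConst (q a b y : ℂ) (N : ℕ) : ℂ :=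
  y ^ (N + 1) * triPow q N
    / (a * b * (qPoch q (-(y / a)) (N + 1) * qPoch q (-(y / b)) (N + 1)))

lemma qPoch_div_qPoch {u : ℂ} (hu : QNonvanishing q u) (N k : ℕ) :
    qPoch q (u * q ^ (N + 1)) k / qPoch q u (k + 1)
      = qPoch q (u * q ^ (k + 1)) N / qPoch q u (N + 1) := by
  rw [div_eq_div_iff (hu.qPoch_ne_zero _) (hu.qPoch_ne_zero _), mul_comm, ← qPoch_add,
    mul_comm (qPoch q (u * q ^ (k + 1)) N), ← qPoch_add]
  congr 1; omega

lemma pairTerm_eq (hq0 : q ≠ 0) (ha : a ≠ 0) (hb : b ≠ 0) (hx : x ≠ 0) (hy : y ≠ 0) {N : ℕ}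
    (hxy : a * b / (x * y) = q ^ N) (hxb : QNonvanishing q (-(x / b)))
    (hyb : QNonvanishing q (-(y / b))) (k : ℕ) :
    pairTerm q a b x y N k = pairConst q a b y N
      * ∏ i ∈ Finset.range N, (indexVal q a b k + nodeVal q a b (x * q ^ i)) := by
  have hab : a * b = x * y * q ^ N := by rw [← hxy]; field_simp
  have e1 : -(q * a / x) = -(y / b) * q ^ (N + 1) := by
    rw [pow_succ]; field_simp; linear_combination -hab
  have e2 : -(q * a / y) = -(x / b) * q ^ (N + 1) := by
    rw [pow_succ]; field_simp; linear_combination -hab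
  have h1 : qPoch q (-(y / b) * q ^ (k + 1)) N
      = ∏ i ∈ Finset.range N, (1 + a * q ^ k / (x * q ^ i)) := by
    rw [qPoch, ← Finset.prod_range_reflect]
    refine Finset.prod_congr rfl fun i hi => ?_
    obtain ⟨j, rfl⟩ := Nat.exists_eq_add_of_lt (Finset.mem_range.1 hi)
    have : i + j + 1 - 1 - i = j := by omega
    rw [this]
    have : a / x = y * q ^ (i + j + 1) / b := by field_simp; linear_combination hab
    have h3 : a * q ^ k / (x * q ^ i) = a / x * (q ^ k / q ^ i) := by field_simp
    rw [h3, this, pow_succ, pow_add]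
    field_simp
    ring
  have h2 : qPoch q (-(x / b)) (N + 1)
      = (a / y) ^ (N + 1) / triPow q N * qPoch q (-(y / a)) (N + 1) := by
    have h4 : triPow q N = ∏ i ∈ Finset.range (N + 1), q ^ i := by
      rw [Finset.prod_range_succ']; simp [triPow]
    rw [h4, ← Finset.card_range (N + 1), ← Finset.prod_const, Finset.card_range, qPoch, qPoch,
      ← Finset.prod_div_distrib, ← Finset.prod_mul_distrib, ← Finset.prod_range_reflect]
    refine Finset.prod_congr rfl fun i hi => ?_
    obtain ⟨j, hj⟩ := Nat.exists_eq_add_of_le (Nat.lt_succ_iff.1 (Finset.mem_range.1 hi))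
    subst hj
    have : i + j + 1 - 1 - i = j := by omega
    rw [this]
    have : x / b = a / (y * q ^ (i + j)) := by field_simp; linear_combination -hab
    rw [this, pow_add]
    field_simp
    ring
  have h3 : ∏ i ∈ Finset.range N, (indexVal q a b k + nodeVal q a b (x * q ^ i))
      = (∏ i ∈ Finset.range N, (1 + a * q ^ k / (x * q ^ i)))
        * qPoch q (-(x / b) * q ^ (k + 1)) N * (1 / q ^ N) ^ k / a ^ N := by
    have h4 : (1 / q ^ N) ^ k = ∏ i ∈ Finset.range N, 1 / q ^ k := by
      rw [Finset.prod_const, Finset.card_range, div_pow, div_pow, one_pow, one_pow, ← pow_mul,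
        ← pow_mul, mul_comm]
    have h5 : a ^ N = ∏ i ∈ Finset.range N, a := by simp
    rw [h4, h5, qPoch, ← Finset.prod_mul_distrib, ← Finset.prod_mul_distrib,
      ← Finset.prod_div_distrib]
    refine Finset.prod_congr rfl fun i _ => ?_
    have := mul_indexVal_add_nodeVal hq0 ha hb (v := x * q ^ i) (by positivity) k
    rw [eq_div_iff ha, mul_comm, this]
    ring
  have hX := hxb.qPoch_ne_zero (N + 1)
  have hY := hyb.qPoch_ne_zero (N + 1)
  have hT := triPow_ne_zero hq0 N
  have hA : qPoch q (-(y / a)) (N + 1) ≠ 0 := by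
    intro h0; rw [h2, h0, mul_zero] at hX; exact hX rfl
  have e5 : qPoch q (-(q * a / x)) k * qPoch q (-(q * a / y)) k
      / (qPoch q (-(x / b)) (k + 1) * qPoch q (-(y / b)) (k + 1))
      = (qPoch q (-(y / b) * q ^ (N + 1)) k / qPoch q (-(y / b)) (k + 1))
        * (qPoch q (-(x / b) * q ^ (N + 1)) k / qPoch q (-(x / b)) (k + 1)) := by
    rw [e1, e2, div_mul_div_comm, mul_comm (qPoch q (-(y / b)) (k + 1))]
  rw [pairTerm, e5, qPoch_div_qPoch hxb, qPoch_div_qPoch hyb, h3, h1, h2, pairConst]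
  generalize (∏ i ∈ Finset.range N, (1 + a * q ^ k / (x * q ^ i))) = P1
  generalize qPoch q (-(x / b) * q ^ (k + 1)) N = P2
  generalize (1 / q ^ N) ^ k = P3
  generalize qPoch q (-(y / a)) (N + 1) = P4 at *
  generalize qPoch q (-(y / b)) (N + 1) = P5 at *
  rw [div_pow, pow_succ a]
  field_simp

/-- The part of the terms of the multiple sum contributed by a pair, at the index `m`, when the
preceding indices have the sum `M`. -/
def pairCoeff (q a b e x y : ℂ) (M m : ℕ) : ℂ :=
  qPoch q (x * y / (a * b)) m / qPoch q q m
    * (qPoch q (q * a * b / (e * x)) M * qPoch q (q * a * b / (e * y)) M * (x * y / (a * b)) ^ M)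
    / (qPoch q (q * x / e) (M + m) * qPoch q (q * y / e) (M + m))

/-- The value of `pairProduct` (see `pairProduct_eq`), written as a finite product. -/
def finPairProduct (q a b e x y : ℂ) (N : ℕ) : ℂ :=
  1 / x * ((-(e / x)) ^ N / triPow q N * qPoch q (q * x / e) N * qPoch q (q * y / e) N)
    / (qPoch q (-(y / a)) (N + 1) * qPoch q (-(y / b)) (N + 1))

/-- The powers collected when `e` is replaced by `e / q^M`. -/
def shiftPow (q a b e : ℂ) (M : ℕ) : ℂ := (a * b / e ^ 2) ^ M * q ^ (M * (M + 1))

lemma gaussBinom_eq (hq0 : q ≠ 0) {z : ℂ} (m L : ℕ) (hz : z * q ^ (m + L) = 1) :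
    qPoch q z m / qPoch q q m
      = (-1) ^ m * (triPow q L / triPow q (m + L)) * gaussBinom q (m + L) m := by
  have h1 : qPoch q z m = (-1) ^ m * (triPow q L / triPow q (m + L))
      * ∏ i ∈ Finset.range m, (1 - q ^ (m + L - i)) := by
    have h2 : triPow q L / triPow q (m + L) = ∏ i ∈ Finset.range m, 1 / q ^ (m + L - i) := by
      rw [div_eq_iff (triPow_ne_zero hq0 _), triPow, triPow, ← Finset.prod_range_reflect _ (m + L),
        Finset.prod_range_add, ← Finset.prod_range_reflect _ L, ← mul_assoc,
        ← Finset.prod_mul_distrib]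
      have h4 : ∏ i ∈ Finset.range m, 1 / q ^ (m + L - i) * q ^ (m + L - 1 - i + 1) = 1 := by
        refine Finset.prod_eq_one fun i hi => ?_
        have := Finset.mem_range.1 hi
        rw [show m + L - 1 - i + 1 = m + L - i by omega]
        field_simp
      rw [h4, one_mul]
      refine Finset.prod_congr rfl fun i hi => ?_
      have := Finset.mem_range.1 hi
      congr 1; omega
    have h3 : (-1 : ℂ) ^ m = ∏ i ∈ Finset.range m, (-1) := by simp
    rw [h2, h3, ← Finset.prod_mul_distrib, ← Finset.prod_mul_distrib, qPoch]
    refine Finset.prod_congr rfl fun i hi => ?_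
    have := Finset.mem_range.1 hi
    obtain ⟨j, hj⟩ := Nat.exists_eq_add_of_le (show i ≤ m + L by omega)
    rw [hj] at hz ⊢
    rw [Nat.add_sub_cancel_left]
    rw [pow_add, ← mul_assoc] at hz
    have : z * q ^ i = 1 / q ^ j := by rw [eq_div_iff (pow_ne_zero _ hq0), hz]
    rw [this]
    field_simp
    ring
  rw [h1, gaussBinom]
  ring

lemma pairConst_mul_newtonCoeff_aux (hq0 : q ≠ 0) {P : ℂ} (hP : P ≠ 0) (hx : x ≠ 0) (he : e ≠ 0)
    (m L M : ℕ) (hxy : P = x * y * q ^ (m + L)) :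
    (P / e ^ 2) ^ M * q ^ (M * (M + 1)) * (y ^ (m + L + 1) * triPow q (m + L) / P)
        * (-(e / q ^ M / q ^ (m + 1))) ^ L * (q / P) ^ L * (triPow q m / (e / q ^ M) ^ m)
      = 1 / x * ((-(e / x)) ^ (m + L) / triPow q (m + L))
        * ((-1) ^ m * (triPow q L / triPow q (m + L))) * (x * y / P) ^ M
        * ((P / e ^ 2) ^ (M + m) * q ^ ((M + m) * (M + m + 1))) := by
  have hy : y = P / (x * q ^ (m + L)) := by rw [hxy]; field_simp
  have h1 : x * y / P = 1 / q ^ (m + L) := by rw [hy]; field_simp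
  have h2 := triPow_sq q (m + L)
  have h3 := triPow_sq q m
  have h4 := triPow_add q m L
  have h5 : (-1 : ℂ) ^ (m + L) * (-1) ^ m = (-1) ^ L := by
    rw [← pow_add, show m + L + m = 2 * m + L by ring, pow_add, pow_mul]; simp
  have h6 : triPow q (m + L) * triPow q m = q ^ (m * (m + 1) + m * L) * triPow q L := by
    rw [h4, pow_add, ← h3]; ring
  have hTL := triPow_ne_zero hq0 L
  have l : (P / e ^ 2) ^ M * q ^ (M * (M + 1)) * (y ^ (m + L + 1) * triPow q (m + L) / P)
        * (-(e / q ^ M / q ^ (m + 1))) ^ L * (q / P) ^ L * (triPow q m / (e / q ^ M) ^ m)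
      = (-1) ^ L * ((P / e ^ 2) ^ M * q ^ (M * (M + 1))
        * (y ^ (m + L + 1) * (triPow q (m + L) * triPow q m) / P)
        * (e / q ^ M / q ^ (m + 1)) ^ L * (q / P) ^ L / (e / q ^ M) ^ m) := by
    rw [neg_pow]; ring
  have r : 1 / x * ((-(e / x)) ^ (m + L) / triPow q (m + L))
        * ((-1) ^ m * (triPow q L / triPow q (m + L))) * (x * y / P) ^ M
        * ((P / e ^ 2) ^ (M + m) * q ^ ((M + m) * (M + m + 1)))
      = ((-1) ^ (m + L) * (-1) ^ m) * (1 / x * (e / x) ^ (m + L) * (triPow q L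
        / triPow q (m + L) ^ 2) * (x * y / P) ^ M
        * ((P / e ^ 2) ^ (M + m) * q ^ ((M + m) * (M + m + 1)))) := by
    rw [neg_pow]; ring
  rw [l, r, h5, h2, h6, h1, hy]
  congr 1
  simp only [div_pow, mul_pow, ← pow_mul, one_pow]
  field_simp
  ring

/-- The coefficients of the expansion of a pair, in the notation of the multiple sum. -/
lemma pairConst_mul_newtonCoeff (hq0 : q ≠ 0) (ha : a ≠ 0) (hb : b ≠ 0) (hx : x ≠ 0) (hy : y ≠ 0)
    (he : e ≠ 0) {N m : ℕ} (M : ℕ) (hm : m ≤ N) (hxy : a * b / (x * y) = q ^ N)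
    (hX : qPoch q (q * x / e) (M + m) ≠ 0) (hY : qPoch q (q * y / e) (M + m) ≠ 0) :
    shiftPow q a b e M * (pairConst q a b y N * newtonCoeff q a b x (e / q ^ M) N m
        * (triPow q m / (e / q ^ M) ^ m))
      = finPairProduct q a b e x y N * pairCoeff q a b e x y M m * shiftPow q a b e (M + m) := by
  have hab : a * b = x * y * q ^ N := by rw [← hxy]; field_simp
  obtain ⟨L, rfl⟩ := Nat.exists_eq_add_of_le hm
  have hab0 : a * b ≠ 0 := mul_ne_zero ha hb
  have a1 : ∏ i ∈ Finset.range L, (x * q ^ i - e / q ^ M / q ^ (m + 1))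
      = (-(e / q ^ M / q ^ (m + 1))) ^ L * qPoch q (q * x / e * q ^ (M + m)) L := by
    rw [qPoch, ← Finset.card_range L, ← Finset.prod_const, Finset.card_range,
      ← Finset.prod_mul_distrib]
    refine Finset.prod_congr rfl fun i _ => ?_
    rw [pow_add, pow_succ]
    field_simp
    ring
  have a2 : ∏ i ∈ Finset.range L, (q / (a * b) - q / (q ^ i * (x * (e / q ^ M))))
      = (q / (a * b)) ^ L * qPoch q (q * y / e * q ^ (M + m)) L := by
    rw [qPoch, ← Finset.card_range L, ← Finset.prod_const, Finset.card_range,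
      ← Finset.prod_mul_distrib, ← Finset.prod_range_reflect]
    refine Finset.prod_congr rfl fun i hi => ?_
    obtain ⟨j, rfl⟩ := Nat.exists_eq_add_of_lt (Finset.mem_range.1 hi)
    rw [show i + j + 1 - 1 - i = j by omega, hab]
    simp only [pow_add, pow_one]
    field_simp
  have e1 : q * a * b / (e * x) = q * y / e * q ^ (m + L) := by
    rw [mul_assoc, hab]; field_simp
  have e2 : q * a * b / (e * y) = q * x / e * q ^ (m + L) := by
    rw [mul_assoc, hab]; field_simp
  have pX : qPoch q (q * x / e) (m + L) * qPoch q (q * x / e * q ^ (m + L)) M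
      = qPoch q (q * x / e) (M + m) * qPoch q (q * x / e * q ^ (M + m)) L := by
    rw [← qPoch_add, ← qPoch_add]; congr 1; omega
  have pY : qPoch q (q * y / e) (m + L) * qPoch q (q * y / e * q ^ (m + L)) M
      = qPoch q (q * y / e) (M + m) * qPoch q (q * y / e * q ^ (M + m)) L := by
    rw [← qPoch_add, ← qPoch_add]; congr 1; omega
  have hz : x * y / (a * b) * q ^ (m + L) = 1 := by rw [hab]; field_simp
  have key := pairConst_mul_newtonCoeff_aux hq0 hab0 hx he m L M hab
  have pXY : qPoch q (q * x / e) (m + L) * qPoch q (q * y / e) (m + L)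
      * (qPoch q (q * y / e * q ^ (m + L)) M * qPoch q (q * x / e * q ^ (m + L)) M)
      / (qPoch q (q * x / e) (M + m) * qPoch q (q * y / e) (M + m))
      = qPoch q (q * x / e * q ^ (M + m)) L * qPoch q (q * y / e * q ^ (M + m)) L := by
    rw [div_eq_iff (mul_ne_zero hX hY)]
    linear_combination (qPoch q (q * y / e) (m + L) * qPoch q (q * y / e * q ^ (m + L)) M) * pX
      + (qPoch q (q * x / e) (M + m) * qPoch q (q * x / e * q ^ (M + m)) L) * pY
  rw [shiftPow, shiftPow, pairConst, newtonCoeff, Nat.add_sub_cancel_left, a1, a2, pairCoeff,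
    finPairProduct, gaussBinom_eq hq0 m L hz, e1, e2]
  linear_combination (gaussBinom q (m + L) m
    / (qPoch q (-(y / a)) (m + L + 1) * qPoch q (-(y / b)) (m + L + 1))) *
    ((qPoch q (q * x / e * q ^ (M + m)) L * qPoch q (q * y / e * q ^ (M + m)) L) * key
      - (1 / x * ((-(e / x)) ^ (m + L) / triPow q (m + L))
        * ((-1) ^ m * (triPow q L / triPow q (m + L))) * (x * y / (a * b)) ^ M
        * ((a * b / e ^ 2) ^ (M + m) * q ^ ((M + m) * (M + m + 1)))) * pXY)

end Pair

/-! ### Induction on the number of pairs -/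

section Induction

variable {q a b c d e : ℂ}

lemma shiftPow_comm (q a b e : ℂ) (M : ℕ) : shiftPow q a b e M = shiftPow q b a e M := by
  rw [shiftPow, shiftPow, mul_comm a b]

lemma shiftPow_ne_zero (hq0 : q ≠ 0) (ha : a ≠ 0) (hb : b ≠ 0) (he : e ≠ 0) (M : ℕ) :
    shiftPow q a b e M ≠ 0 := by
  unfold shiftPow; positivity

lemma finPairProduct_comm (q a b e x y : ℂ) (N : ℕ) :
    finPairProduct q a b e x y N = finPairProduct q b a e x y N := by
  rw [finPairProduct, finPairProduct, mul_comm (qPoch q (-(y / a)) (N + 1))]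

lemma pairCoeff_comm (q a b e x y : ℂ) (M m : ℕ) :
    pairCoeff q a b e x y M m = pairCoeff q b a e x y M m := by
  rw [pairCoeff, pairCoeff, mul_comm a b, mul_right_comm q a b]

lemma shiftPow_mul_pairTerm_mul_regFactor (hq0 : q ≠ 0) (hq : ‖q‖ < 1) (ha : a ≠ 0) (hb : b ≠ 0)
    {x y : ℂ} (hx : x ≠ 0) (hy : y ≠ 0) (he : e ≠ 0) {N M : ℕ}
    (hxy : a * b / (x * y) = q ^ N) (hxb : QNonvanishing q (-(x / b)))
    (hyb : QNonvanishing q (-(y / b))) (hX : qPoch q (q * x / e) (M + N) ≠ 0)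
    (hY : qPoch q (q * y / e) (M + N) ≠ 0) (k : ℕ) :
    shiftPow q a b e M * (pairTerm q a b x y N k * regFactor q a b (e / q ^ M) k)
      = finPairProduct q a b e x y N * ∑ m ∈ Finset.range (N + 1), pairCoeff q a b e x y M m
        * (shiftPow q a b e (M + m) * regFactor q a b (e / q ^ (M + m)) k) := by
  have he' : e / q ^ M ≠ 0 := by positivity
  rw [pairTerm_eq hq0 ha hb hx hy hxy hxb hyb, prod_add_nodeVal hq0 hq ha hb hx he',
    Finset.mul_sum, Finset.sum_mul, Finset.mul_sum, Finset.mul_sum]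
  refine Finset.sum_congr rfl fun m hm => ?_
  have hm' : m ≤ N := Nat.lt_succ_iff.1 (Finset.mem_range.1 hm)
  have h1 := pairConst_mul_newtonCoeff hq0 ha hb hx hy he M hm' hxy
    (qPoch_ne_zero_of_le hX (by omega)) (qPoch_ne_zero_of_le hY (by omega))
  have h2 := regFactor_div_pow hq0 hq ha hb he' m k
  have h3 : ∏ i ∈ Finset.range m, (e / q ^ M / q ^ (i + 1)) = (e / q ^ M) ^ m / triPow q m := by
    rw [triPow, Finset.prod_div_distrib, Finset.prod_const, Finset.card_range]
  have h4 : triPow q m / (e / q ^ M) ^ m * ((e / q ^ M) ^ m / triPow q m) = 1 := by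
    have := triPow_ne_zero hq0 m
    have := pow_ne_zero m he'
    field_simp
  rw [Finset.prod_mul_distrib, h3, div_div, ← pow_add] at h2
  rw [h2]
  linear_combination (regFactor q a b (e / q ^ M) k * ((e / q ^ M) ^ m / triPow q m)
      * ∏ i ∈ Finset.range m, (indexVal q a b k + nodeVal q a b (e / q ^ M / q ^ (i + 1)))) * h1
    - (shiftPow q a b e M * pairConst q a b y N * newtonCoeff q a b x (e / q ^ M) N m
      * regFactor q a b (e / q ^ M) k
      * ∏ i ∈ Finset.range m, (indexVal q a b k + nodeVal q a b (e / q ^ M / q ^ (i + 1)))) * h4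

/-- The `k`-th term of the regularized series with pairs. -/
def regPairTerm {n : ℕ} (q a b c d e : ℂ) (x y : Fin n → ℂ) (N : Fin n → ℕ) (k : ℕ) : ℂ :=
  regTerm q a b c d e k * ∏ i, pairTerm q a b (x i) (y i) (N i) k

lemma shiftPow_mul_regPairTerm_succ {n : ℕ} (hq0 : q ≠ 0) (hq : ‖q‖ < 1) (ha : a ≠ 0)
    (hb : b ≠ 0) (he : e ≠ 0) (c d : ℂ) {x y : Fin (n + 1) → ℂ} {N : Fin (n + 1) → ℕ} {M : ℕ}
    (hx : x 0 ≠ 0) (hy : y 0 ≠ 0) (hxy : a * b / (x 0 * y 0) = q ^ N 0)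
    (hxb : QNonvanishing q (-(x 0 / b))) (hyb : QNonvanishing q (-(y 0 / b)))
    (hX : qPoch q (q * x 0 / e) (M + N 0) ≠ 0) (hY : qPoch q (q * y 0 / e) (M + N 0) ≠ 0) (k : ℕ) :
    shiftPow q a b e M * regPairTerm q a b c d (e / q ^ M) x y N k
      = finPairProduct q a b e (x 0) (y 0) (N 0) * ∑ m ∈ Finset.range (N 0 + 1),
        pairCoeff q a b e (x 0) (y 0) M m * (shiftPow q a b e (M + m)
          * regPairTerm q a b c d (e / q ^ (M + m)) (fun i => x i.succ) (fun i => y i.succ)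
            (fun i => N i.succ) k) := by
  have h := shiftPow_mul_pairTerm_mul_regFactor hq0 hq ha hb hx hy he hxy hxb hyb hX hY k
  set P := ∏ i : Fin n, pairTerm q a b (x i.succ) (y i.succ) (N i.succ) k with hP
  set A := baseFactor q a b k * (regFactor q a b c k * regFactor q a b d k)
    * (1 / (q * a * b)) ^ k with hA
  have h1 : shiftPow q a b e M * regPairTerm q a b c d (e / q ^ M) x y N k
      = A * P * (shiftPow q a b e M
        * (pairTerm q a b (x 0) (y 0) (N 0) k * regFactor q a b (e / q ^ M) k)) := by
    rw [regPairTerm, regTerm, Fin.prod_univ_succ, ← hP, hA]; ring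
  rw [h1, h, mul_left_comm, Finset.mul_sum]
  congr 1
  refine Finset.sum_congr rfl fun m _ => ?_
  rw [regPairTerm, regTerm, ← hP, hA]; ring

/-- The part of the terms of the multiple sum that depends on `M = m_1 + ⋯ + m_n` only. -/
def finalCoeff (q a b c d e : ℂ) (M : ℕ) : ℂ :=
  qPoch q (q / e) M * qPoch q (q * a * b / (c * e)) M * qPoch q (q * a * b / (d * e)) M
    / qPoch q (q ^ 2 * a * b / (c * d * e)) M * q ^ M

/-- The value of `regSum q a b c d e`. -/
def regConst (q a b c d e : ℂ) : ℂ :=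
  (1 / b - 1 / a) * (qPochInf q q * qPochInf q (q * a / b) * qPochInf q (q * b / a))
    / (qPochInf q (-(q * a)) * qPochInf q (-(q * b)))
    * (qPochInf q c * qPochInf q d * qPochInf q e * qPochInf q (c * d / (a * b))
      * qPochInf q (c * e / (a * b)) * qPochInf q (d * e / (a * b)))
    / qPochInf q (c * d * e / (q * a * b))

lemma qPochInf_div_pow (hq0 : q ≠ 0) (hq : ‖q‖ < 1) {z : ℂ} (hz : z ≠ 0) (M : ℕ) :
    qPochInf q (z / q ^ M) = (-z) ^ M / triPow q M * qPoch q (q / z) M * qPochInf q z := by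
  induction M with
  | zero => simp [triPow]
  | succ M ih =>
    have h1 : z / q ^ (M + 1) * q = z / q ^ M := by rw [pow_succ]; field_simp
    rw [qPochInf_eq_mul hq, h1, ih, qPoch_succ, triPow_succ]
    have h2 : 1 - z / q ^ (M + 1) = -z / q ^ (M + 1) * (1 - q / z * q ^ M) := by
      rw [pow_succ]; field_simp; ring
    rw [h2]
    ring

lemma shiftPow_mul_regSum (hq0 : q ≠ 0) (hq : ‖q‖ < 1) (ha : a ≠ 0) (hb : b ≠ 0)
    (hc : c ≠ 0) (hd : d ≠ 0) (he : e ≠ 0)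
    (hqa : QNonvanishing q (-(q * a))) (hqb : QNonvanishing q (-(q * b))) (M : ℕ)
    (h : ‖c * d * (e / q ^ M)‖ < ‖q * a * b‖) :
    shiftPow q a b e M * regSum q a b c d (e / q ^ M)
      = regConst q a b c d e * finalCoeff q a b c d e M := by
  have hS := regSum_eq hq0 hq ha hb hqa hqb h
  have e1 : c * d * (e / q ^ M) / (q * a * b) = c * d * e / (q * a * b) / q ^ M := by ring
  have e2 : c * (e / q ^ M) / (a * b) = c * e / (a * b) / q ^ M := by ring
  have e3 : d * (e / q ^ M) / (a * b) = d * e / (a * b) / q ^ M := by ring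
  have hne : qPochInf q (c * d * (e / q ^ M) / (q * a * b)) ≠ 0 :=
    (qNonvanishing_of_norm_lt_one hq (by
      rw [norm_div]; exact (div_lt_one ((norm_nonneg _).trans_lt h)).2 h)).qPochInf_ne_zero hq
  rw [e1, qPochInf_div_pow hq0 hq (by positivity)] at hne
  rw [e1, e2, e3, qPochInf_div_pow hq0 hq (z := c * d * e / (q * a * b)) (by positivity),
    qPochInf_div_pow hq0 hq he, qPochInf_div_pow hq0 hq (z := c * e / (a * b)) (by positivity),
    qPochInf_div_pow hq0 hq (z := d * e / (a * b)) (by positivity)] at hS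
  have f1 : q / (c * d * e / (q * a * b)) = q ^ 2 * a * b / (c * d * e) := by field_simp
  have f2 : q / (c * e / (a * b)) = q * a * b / (c * e) := by field_simp
  have f3 : q / (d * e / (a * b)) = q * a * b / (d * e) := by field_simp
  rw [f1] at hne
  rw [f1, f2, f3] at hS
  have hT := triPow_ne_zero hq0 M
  have hT2 := triPow_sq q M
  obtain ⟨hne1, hI⟩ := mul_ne_zero_iff.1 hne
  obtain ⟨-, hp⟩ := mul_ne_zero_iff.1 hne1
  rw [shiftPow, regConst, finalCoeff, ← hT2]
  generalize qPochInf q (c * d * e / (q * a * b)) = I1 at *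
  generalize qPoch q (q ^ 2 * a * b / (c * d * e)) M = p at *
  apply mul_left_cancel₀ hne
  have hmono : (a * b / e ^ 2) ^ M * triPow q M ^ 2 * ((-e) ^ M / triPow q M
      * ((-(c * e / (a * b))) ^ M / triPow q M) * ((-(d * e / (a * b))) ^ M / triPow q M))
      = (-(c * d * e / (q * a * b))) ^ M / triPow q M * q ^ M := by
    have : a * b / e ^ 2 * (-e * -(c * e / (a * b)) * -(d * e / (a * b)))
        = -(c * d * e / (q * a * b)) * q := by field_simp
    rw [div_mul_eq_mul_div _ _ (q ^ M), ← mul_pow, ← this, mul_pow, mul_pow, mul_pow]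
    field_simp
  set T := triPow q M
  set W := (-(c * d * e / (q * a * b))) ^ M
  have hr : W / T * p * I1 * ((1 / b - 1 / a)
        * (qPochInf q q * qPochInf q (q * a / b) * qPochInf q (q * b / a))
        / (qPochInf q (-(q * a)) * qPochInf q (-(q * b)))
        * (qPochInf q c * qPochInf q d * qPochInf q e * qPochInf q (c * d / (a * b))
          * qPochInf q (c * e / (a * b)) * qPochInf q (d * e / (a * b))) / I1
        * (qPoch q (q / e) M * qPoch q (q * a * b / (c * e)) M * qPoch q (q * a * b / (d * e)) M
          / p * q ^ M))
      = (W / T * q ^ M) * ((1 / b - 1 / a)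
        * (qPochInf q q * qPochInf q (q * a / b) * qPochInf q (q * b / a))
        / (qPochInf q (-(q * a)) * qPochInf q (-(q * b)))
        * (qPochInf q c * qPochInf q d * qPochInf q e * qPochInf q (c * d / (a * b))
          * qPochInf q (c * e / (a * b)) * qPochInf q (d * e / (a * b)))
        * (qPoch q (q / e) M * qPoch q (q * a * b / (c * e)) M
          * qPoch q (q * a * b / (d * e)) M)) := by
    have g1 : p * p⁻¹ = 1 := mul_inv_cancel₀ hp
    have g2 : I1 * I1⁻¹ = 1 := mul_inv_cancel₀ hI
    simp only [div_eq_mul_inv _ p, div_eq_mul_inv _ I1]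
    generalize (1 / b - 1 / a)
        * (qPochInf q q * qPochInf q (q * a / b) * qPochInf q (q * b / a))
        / (qPochInf q (-(q * a)) * qPochInf q (-(q * b))) = U
    generalize qPochInf q c * qPochInf q d * qPochInf q e * qPochInf q (c * d / (a * b))
          * qPochInf q (c * e / (a * b)) * qPochInf q (d * e / (a * b)) = V
    generalize qPoch q (q / e) M * qPoch q (q * a * b / (c * e)) M
          * qPoch q (q * a * b / (d * e)) M = Z
    linear_combination (W / T * q ^ M * U * V * Z) * (I1 * I1⁻¹ * g1 + g2)
  rw [hr, ← hmono]
  linear_combination ((a * b / e ^ 2) ^ M * T ^ 2) * hS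

/-- The summand of the multiple sum with all partial sums shifted by `M`. -/
def shiftedMultiTerm {n : ℕ} (q a b c d e : ℂ) (M : ℕ) (x y : Fin n → ℂ) (m : Fin n → ℕ) : ℂ :=
  (∏ s, pairCoeff q a b e (x s) (y s) (M + ∑ i ∈ Finset.Iio s, m i) (m s))
    * finalCoeff q a b c d e (M + ∑ i, m i)

lemma sum_Iio_succ {n : ℕ} (m : Fin (n + 1) → ℕ) (s : Fin n) :
    ∑ i ∈ Finset.Iio s.succ, m i = m 0 + ∑ i ∈ Finset.Iio s, m i.succ := by
  have h1 : (Finset.Iio s.succ) = Finset.univ.filter (· < s.succ) := by ext; simp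
  have h2 : (Finset.Iio s) = Finset.univ.filter (· < s) := by ext; simp
  rw [h1, h2, Finset.sum_filter, Finset.sum_filter, Fin.sum_univ_succ]
  simp

lemma shiftedMultiTerm_succ {n : ℕ} (q a b c d e : ℂ) (M : ℕ) (x y : Fin (n + 1) → ℂ)
    (m : Fin (n + 1) → ℕ) :
    shiftedMultiTerm q a b c d e M x y m = pairCoeff q a b e (x 0) (y 0) M (m 0)
      * shiftedMultiTerm q a b c d e (M + m 0) (fun i => x i.succ) (fun i => y i.succ)
        (fun i => m i.succ) := by
  rw [shiftedMultiTerm, shiftedMultiTerm, Fin.prod_univ_succ, Fin.sum_univ_succ]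
  have : Finset.Iio (0 : Fin (n + 1)) = ∅ := by ext; simp
  simp only [sum_Iio_succ, this, Finset.sum_empty, add_zero, add_assoc]
  ring

lemma sum_piFinset_succ {n : ℕ} (s : Fin (n + 1) → Finset ℕ) (f : (Fin (n + 1) → ℕ) → ℂ) :
    ∑ m ∈ Fintype.piFinset s, f m
      = ∑ j ∈ s 0, ∑ m ∈ Fintype.piFinset fun i => s i.succ, f (Fin.cons j m) := by
  rw [← Finset.sum_product']
  refine Finset.sum_nbij' (fun m => (m 0, fun i => m i.succ)) (fun p => Fin.cons p.1 p.2)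
    ?_ ?_ ?_ ?_ ?_
  · intro m hm
    rw [Fintype.mem_piFinset] at hm
    simp [hm]
  · rintro ⟨j, m⟩ hm
    rw [Finset.mem_product, Fintype.mem_piFinset] at hm
    rw [Fintype.mem_piFinset]
    intro i
    refine Fin.cases ?_ (fun i => ?_) i
    · simpa using hm.1
    · simpa using hm.2 i
  · intro m _
    exact Fin.cons_self_tail m
  · rintro ⟨j, m⟩ _
    simp
  · intro m _
    congr 1
    exact (Fin.cons_self_tail m).symm

lemma partialSum_succ {n : ℕ} (m : Fin (n + 1) → ℕ) (s : Fin n) :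
    partialSum m s.succ = m 0 + partialSum (fun i => m i.succ) s := by
  have h1 : (Finset.Iic s.succ) = Finset.univ.filter (· ≤ s.succ) := by ext; simp
  have h2 : (Finset.Iic s) = Finset.univ.filter (· ≤ s) := by ext; simp
  rw [partialSum, partialSum, h1, h2, Finset.sum_filter, Finset.sum_filter, Fin.sum_univ_succ]
  simp

lemma partialSum_zero {n : ℕ} (m : Fin (n + 1) → ℕ) : partialSum m 0 = m 0 := by
  have : Finset.Iic (0 : Fin (n + 1)) = {0} := by ext; simp
  rw [partialSum, this, Finset.sum_singleton]

/-- Summability and evaluation of the regularized series with pairs, with `e` replaced by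
`e / q^M`; the shift `M` is what makes the induction on the number of pairs possible. -/
theorem regPairTerm_summable_and_eq (hq0 : q ≠ 0) (hq : ‖q‖ < 1) (ha : a ≠ 0) (hb : b ≠ 0)
    (hc : c ≠ 0) (hd : d ≠ 0) (he : e ≠ 0)
    (hqa : QNonvanishing q (-(q * a))) (hqb : QNonvanishing q (-(q * b))) (n : ℕ) :
    ∀ (x y : Fin n → ℂ) (N : Fin n → ℕ) (M : ℕ),
      (∀ i, x i ≠ 0) → (∀ i, y i ≠ 0) → (∀ i, a * b / (x i * y i) = q ^ N i) →
      (∀ i, QNonvanishing q (-(x i / a))) → (∀ i, QNonvanishing q (-(x i / b))) →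
      (∀ i, QNonvanishing q (-(y i / a))) → (∀ i, QNonvanishing q (-(y i / b))) →
      ‖c * d * (e / q ^ (M + ∑ i, N i))‖ < ‖q * a * b‖ →
      (∀ s, qPoch q (q * x s / e) (M + partialSum N s) ≠ 0) →
      (∀ s, qPoch q (q * y s / e) (M + partialSum N s) ≠ 0) →
      Summable (regPairTerm q a b c d (e / q ^ M) x y N) ∧
      Summable (regPairTerm q b a c d (e / q ^ M) x y N) ∧
      shiftPow q a b e M * (∑' k, regPairTerm q a b c d (e / q ^ M) x y N k
          - ∑' k, regPairTerm q b a c d (e / q ^ M) x y N k)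
        = regConst q a b c d e * (∏ i, finPairProduct q a b e (x i) (y i) (N i))
          * ∑ m ∈ Fintype.piFinset fun i => Finset.range (N i + 1),
            shiftedMultiTerm q a b c d e M x y m := by
  induction n with
  | zero =>
    intro x y N M _ _ _ _ _ _ _ h _ _
    simp only [Finset.univ_eq_empty, Finset.sum_empty, add_zero] at h
    have hba : ‖c * d * (e / q ^ M)‖ < ‖q * b * a‖ := by rwa [mul_right_comm q b a]
    have e1 : regPairTerm q a b c d (e / q ^ M) x y N = regTerm q a b c d (e / q ^ M) := by
      ext k; simp [regPairTerm]
    have e2 : regPairTerm q b a c d (e / q ^ M) x y N = regTerm q b a c d (e / q ^ M) := by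
      ext k; simp [regPairTerm]
    have := shiftPow_mul_regSum hq0 hq ha hb hc hd he hqa hqb M h
    rw [e1, e2]
    refine ⟨summable_regTerm hq hqa h, summable_regTerm hq hqb hba, ?_⟩
    rw [regSum] at this
    simp [this, shiftedMultiTerm]
  | succ n ih =>
    intro x y N M hx hy hxy hxa hxb hya hyb h hX hY
    have hX0 := hX 0
    have hY0 := hY 0
    rw [partialSum_zero] at hX0 hY0
    have hyx : ∀ i, b * a / (x i * y i) = q ^ N i := fun i => by rw [mul_comm b a, hxy]
    have IH := fun m (hm : m ∈ Finset.range (N 0 + 1)) =>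
      ih (fun i => x i.succ) (fun i => y i.succ) (fun i => N i.succ) (M + m)
        (fun i => hx _) (fun i => hy _) (fun i => hxy _) (fun i => hxa _) (fun i => hxb _)
        (fun i => hya _) (fun i => hyb _)
        (by
          refine lt_of_le_of_lt ?_ h
          rw [Fin.sum_univ_succ, norm_mul, norm_mul (c * d), norm_div, norm_div, norm_pow, norm_pow]
          have hm' := Finset.mem_range.1 hm
          have hq' : 0 < ‖q‖ := norm_pos_iff.2 hq0
          gcongr ‖c * d‖ * (‖e‖ / ?_)
          exact pow_le_pow_of_le_one (norm_nonneg _) hq.le (by omega))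
        (fun s => by
          have h1 := hX s.succ
          have hm' := Finset.mem_range.1 hm
          rw [partialSum_succ] at h1
          exact qPoch_ne_zero_of_le h1 (by omega))
        (fun s => by
          have h1 := hY s.succ
          have hm' := Finset.mem_range.1 hm
          rw [partialSum_succ] at h1
          exact qPoch_ne_zero_of_le h1 (by omega))
    have hab := shiftPow_mul_regPairTerm_succ hq0 hq ha hb he c d (hx 0) (hy 0) (hxy 0) (hxb 0)
      (hyb 0) hX0 hY0
    have hba := shiftPow_mul_regPairTerm_succ hq0 hq hb ha he c d (hx 0) (hy 0) (hyx 0) (hxa 0)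
      (hya 0) hX0 hY0
    simp only [shiftPow_comm q b a, finPairProduct_comm q b a, pairCoeff_comm q b a] at hba
    have hsp := shiftPow_ne_zero hq0 ha hb he M
    have s1 := fun m hm => (((IH m hm).1.mul_left (shiftPow q a b e (M + m))).mul_left
      (pairCoeff q a b e (x 0) (y 0) M m))
    have s2 := fun m hm => (((IH m hm).2.1.mul_left (shiftPow q a b e (M + m))).mul_left
      (pairCoeff q a b e (x 0) (y 0) M m))
    refine ⟨?_, ?_, ?_⟩
    · rw [← summable_mul_left_iff hsp]
      simp only [hab]
      exact (summable_sum s1).mul_left _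
    · rw [← summable_mul_left_iff hsp]
      simp only [hba]
      exact (summable_sum s2).mul_left _
    · rw [mul_sub, ← tsum_mul_left, ← tsum_mul_left]
      simp only [hab, hba]
      rw [tsum_mul_left, tsum_mul_left, Summable.tsum_finsetSum s1, Summable.tsum_finsetSum s2,
        ← mul_sub, ← Finset.sum_sub_distrib, Fin.prod_univ_succ, sum_piFinset_succ]
      have : ∀ m ∈ Finset.range (N 0 + 1),
          ∑' k, pairCoeff q a b e (x 0) (y 0) M m * (shiftPow q a b e (M + m)
            * regPairTerm q a b c d (e / q ^ (M + m)) (fun i => x i.succ) (fun i => y i.succ)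
              (fun i => N i.succ) k)
          - ∑' k, pairCoeff q a b e (x 0) (y 0) M m * (shiftPow q a b e (M + m)
            * regPairTerm q b a c d (e / q ^ (M + m)) (fun i => x i.succ) (fun i => y i.succ)
              (fun i => N i.succ) k)
          = regConst q a b c d e
            * (∏ i : Fin n, finPairProduct q a b e (x i.succ) (y i.succ) (N i.succ))
            * ∑ m' ∈ Fintype.piFinset fun i : Fin n => Finset.range (N i.succ + 1),
              shiftedMultiTerm q a b c d e M x y (Fin.cons m m') := by
        intro m hm
        have h3 := (IH m hm).2.2
        simp only [shiftedMultiTerm_succ, Fin.cons_zero, Fin.cons_succ]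
        rw [tsum_mul_left, tsum_mul_left, tsum_mul_left, tsum_mul_left, ← mul_sub, ← mul_sub, h3,
          ← Finset.mul_sum]
        ring
      rw [Finset.sum_congr rfl this, ← Finset.mul_sum]
      ring

end Induction

/-! ### Return to the unregularized series and to the multiple sum -/

section Final

variable {q a b c d e : ℂ}

lemma pairProduct_eq (hq0 : q ≠ 0) (hq : ‖q‖ < 1) (ha : a ≠ 0) (hb : b ≠ 0) (he : e ≠ 0)
    {x y : ℂ} (hx : x ≠ 0) (hy : y ≠ 0) {N : ℕ} (hxy : a * b / (x * y) = q ^ N)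
    (hya : QNonvanishing q (-(y / a))) (hyb : QNonvanishing q (-(y / b)))
    (hex : QNonvanishing q (e / x)) (hex' : QNonvanishing q (q * a * b / (e * x))) :
    pairProduct q a b e x y = finPairProduct q a b e x y N := by
  have hab : a * b = x * y * q ^ N := by rw [← hxy]; field_simp
  have e1 : -(q * a / x) = -(y / b) * q ^ (N + 1) := by
    rw [pow_succ]; field_simp; linear_combination -hab
  have e2 : -(q * b / x) = -(y / a) * q ^ (N + 1) := by
    rw [pow_succ]; field_simp; linear_combination -hab
  have e3 : q * a * b / (e * x) = q * y / e * q ^ N := by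
    rw [mul_assoc, hab]; field_simp
  have e4 : e * y / (a * b) = e / x / q ^ N := by
    rw [hab]; field_simp
  have e5 : q / (e / x) = q * x / e := by field_simp
  have n1 := hya.qPochInf_ne_zero hq
  have n2 := hyb.qPochInf_ne_zero hq
  have n3 := hex.qPochInf_ne_zero hq
  have n4 := hex'.qPochInf_ne_zero hq
  rw [e3] at n4
  rw [pairProduct, finPairProduct, e1, e2, e3, e4, qPochInf_div_pow hq0 hq (by positivity) N,
    qPochInf_eq_qPoch_mul hq (q * y / e) N, e5]
  rw [qPochInf_eq_qPoch_mul hq (-(y / a)) (N + 1)] at n1 ⊢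
  rw [qPochInf_eq_qPoch_mul hq (-(y / b)) (N + 1)] at n2 ⊢
  obtain ⟨n5, n6⟩ := mul_ne_zero_iff.1 n1
  obtain ⟨n7, n8⟩ := mul_ne_zero_iff.1 n2
  have hT := triPow_ne_zero hq0 N
  generalize qPochInf q (-(y / a) * q ^ (N + 1)) = I1 at *
  generalize qPochInf q (-(y / b) * q ^ (N + 1)) = I2 at *
  generalize qPochInf q (e / x) = I3 at *
  generalize qPochInf q (q * y / e * q ^ N) = I4 at *
  generalize qPoch q (-(y / a)) (N + 1) = I5 at *
  generalize qPoch q (-(y / b)) (N + 1) = I6 at *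
  generalize (-(e / x)) ^ N = I7 at *
  field_simp

/-- The factor by which the series is multiplied on regularization. -/
def regScale (q a b c d e : ℂ) : ℂ :=
  qPochInf q (-(c / b)) * qPochInf q (-(c / a)) * (qPochInf q (-(d / b)) * qPochInf q (-(d / a)))
    * (qPochInf q (-(e / b)) * qPochInf q (-(e / a)))

lemma regScale_comm (q a b c d e : ℂ) : regScale q a b c d e = regScale q b a c d e := by
  unfold regScale; ring

lemma fiveVarProduct_eq (q a b c d e : ℂ) :
    fiveVarProduct q a b c d e = regConst q a b c d e / regScale q a b c d e := by
  rw [fiveVarProduct, regConst, regScale]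
  generalize 1 / b - 1 / a = U
  simp only [div_eq_mul_inv (_ * _), mul_inv]
  ring

lemma regFactor_eq_qPoch (hq : ‖q‖ < 1) (a : ℂ) {f : ℂ} (hf : f ≠ 0)
    (hfb : QNonvanishing q (-(f / b))) (k : ℕ) :
    regFactor q a b f k = f ^ k * (qPoch q (-(q * a / f)) k / qPoch q (-(f / b)) (k + 1))
      * (qPochInf q (-(f / b)) * qPochInf q (-(f / a))) := by
  have h1 : shiftProd q a f k = f ^ k * qPoch q (-(q * a / f)) k := by
    rw [shiftProd, qPoch, ← Finset.card_range k, ← Finset.prod_const, Finset.card_range,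
      ← Finset.prod_mul_distrib]
    refine Finset.prod_congr rfl fun i _ => ?_
    rw [pow_succ]
    field_simp
    ring
  have h2 : -(f * q ^ (k + 1) / b) = -(f / b) * q ^ (k + 1) := by ring
  have h3 := hfb.qPoch_ne_zero (k + 1)
  rw [regFactor, h1, h2, qPochInf_eq_qPoch_mul hq (-(f / b)) (k + 1)]
  field_simp

lemma regPairTerm_eq (hq0 : q ≠ 0) (hq : ‖q‖ < 1) (ha : a ≠ 0) (hb : b ≠ 0)
    (hc : c ≠ 0) (hd : d ≠ 0) (he : e ≠ 0) (hcb : QNonvanishing q (-(c / b)))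
    (hdb : QNonvanishing q (-(d / b))) (heb : QNonvanishing q (-(e / b))) {n : ℕ}
    (x y : Fin n → ℂ) (N : Fin n → ℕ) (k : ℕ) :
    regPairTerm q a b c d e x y N k
      = regScale q a b c d e * (1 / b ^ n) * rhoTerm q a b c d e x y (∑ i, N i) k := by
  have h1 : ∏ i, pairTerm q a b (x i) (y i) (N i) k
      = 1 / b ^ n * ((∏ i, (qPoch q (-(q * a / x i)) k * qPoch q (-(q * a / y i)) k))
        / ∏ i, (qPoch q (-(x i / b)) (k + 1) * qPoch q (-(y i / b)) (k + 1)))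
        * (1 / q ^ ∑ i, N i) ^ k := by
    simp only [pairTerm, Finset.prod_mul_distrib, Finset.prod_div_distrib, Finset.prod_pow,
      Finset.prod_const, Finset.prod_pow_eq_pow_sum, Finset.card_univ, Fintype.card_fin, one_pow]
  have h2 : (c * d * e / (a * b * q ^ ((∑ i, N i) + 1))) ^ k
      = c ^ k * d ^ k * e ^ k * (1 / (q * a * b)) ^ k * (1 / q ^ ∑ i, N i) ^ k := by
    rw [← mul_pow, ← mul_pow, ← mul_pow, ← mul_pow, pow_succ]
    congr 1
    field_simp
  rw [regPairTerm, regTerm, baseFactor, regFactor_eq_qPoch hq a hc hcb,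
    regFactor_eq_qPoch hq a hd hdb, regFactor_eq_qPoch hq a he heb, h1, rhoTerm, h2, regScale]
  ring

lemma sum_Iio_add_eq_partialSum {n : ℕ} (m : Fin n → ℕ) (s : Fin n) :
    ∑ i ∈ Finset.Iio s, m i + m s = partialSum m s := by
  rw [partialSum, ← Finset.Iio_insert, Finset.sum_insert (by simp), add_comm]

lemma multiTerm_eq {n : ℕ} (q a b c d e : ℂ) (x y : Fin n → ℂ) (m : Fin n → ℕ) :
    multiTerm q a b c d e x y m = shiftedMultiTerm q a b c d e 0 x y m := by
  cases n with
  | zero => simp [multiTerm, shiftedMultiTerm, finalCoeff]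
  | succ n =>
    have h0 : ∑ i ∈ Finset.Iio (0 : Fin (n + 1)), m i = 0 := by
      have : Finset.Iio (0 : Fin (n + 1)) = ∅ := by ext; simp
      simp [this]
    have hs : ∀ s : Fin n, ∑ i ∈ Finset.Iio s.succ, m i = partialSum m s.castSucc := by
      intro s
      rw [partialSum]
      rfl
    have hl : ∑ i, m i = partialSum m (Fin.last n) := by
      rw [partialSum]
      congr 1
      ext i
      simp [Fin.le_last]
    -- in `shiftedMultiTerm` numerators and denominators of a pair stand together
    have h1 : ∏ s, pairCoeff q a b e (x s) (y s) (0 + ∑ i ∈ Finset.Iio s, m i) (m s)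
        = (∏ s, qPoch q (x s * y s / (a * b)) (m s) / qPoch q q (m s))
          * (∏ s : Fin n, qPoch q (q * a * b / (e * x s.succ)) (partialSum m s.castSucc)
            * qPoch q (q * a * b / (e * y s.succ)) (partialSum m s.castSucc)
            * (x s.succ * y s.succ / (a * b)) ^ partialSum m s.castSucc)
          / ∏ s, (qPoch q (q * x s / e) (partialSum m s)
            * qPoch q (q * y s / e) (partialSum m s)) := by
      simp only [pairCoeff, zero_add, sum_Iio_add_eq_partialSum]
      rw [Finset.prod_div_distrib, Finset.prod_mul_distrib]
      congr 2
      rw [Fin.prod_univ_succ]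
      simp [h0, hs]
    rw [shiftedMultiTerm, h1, zero_add, hl, multiTerm, Fin.prod_univ_castSucc (n := n),
      Fin.prod_univ_castSucc (n := n), finalCoeff]
    simp only [Finset.prod_mul_distrib, Finset.prod_div_distrib]
    ring

lemma multiTerm_eq_zero (ha : a ≠ 0) (hb : b ≠ 0) (c d e : ℂ) {n : ℕ}
    {x y : Fin n → ℂ} {N : Fin n → ℕ} (hx : ∀ i, x i ≠ 0) (hy : ∀ i, y i ≠ 0)
    (hxy : ∀ i, a * b / (x i * y i) = q ^ N i) {m : Fin n → ℕ}
    (hm : m ∉ Fintype.piFinset fun i => Finset.range (N i + 1)) :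
    multiTerm q a b c d e x y m = 0 := by
  simp only [Fintype.mem_piFinset, Finset.mem_range, not_forall, not_lt] at hm
  obtain ⟨s, hs⟩ := hm
  have h0 : qPoch q (x s * y s / (a * b)) (m s) = 0 := by
    refine Finset.prod_eq_zero (Finset.mem_range.2 (show N s < m s by omega)) ?_
    have := hx s
    have := hy s
    rw [← hxy s]
    field_simp
    ring
  rw [multiTerm_eq, shiftedMultiTerm, Finset.prod_eq_zero (Finset.mem_univ s), zero_mul]
  simp [pairCoeff, h0]

end Final

end RamanujanReciprocity

end

open RamanujanReciprocity in
theorem theorem2p6 (n : ℕ) (q a b c d e : ℂ) (x y : Fin n → ℂ) (N : Fin n → ℕ)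
    (hq0 : q ≠ 0) (hq1 : ‖q‖ < 1)
    (ha : a ≠ 0) (hb : b ≠ 0) (hc : c ≠ 0) (hd : d ≠ 0) (he : e ≠ 0)
    (hx : ∀ i, x i ≠ 0) (hy : ∀ i, y i ≠ 0)
    (hxy : ∀ i, a * b / (x i * y i) = q ^ N i)
    (hconv : ‖c * d * e / (a * b * q ^ ((∑ i, N i) + 1))‖ < 1)
    -- the denominators of the two one-fold series and of the infinite products do not vanish
    (hqa : QNonvanishing q (-(q * a))) (hqb : QNonvanishing q (-(q * b)))
    (hca : QNonvanishing q (-(c / a))) (hcb : QNonvanishing q (-(c / b)))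
    (hda : QNonvanishing q (-(d / a))) (hdb : QNonvanishing q (-(d / b)))
    (hea : QNonvanishing q (-(e / a))) (heb : QNonvanishing q (-(e / b)))
    (hxa : ∀ i, QNonvanishing q (-(x i / a))) (hxb : ∀ i, QNonvanishing q (-(x i / b)))
    (hya : ∀ i, QNonvanishing q (-(y i / a))) (hyb : ∀ i, QNonvanishing q (-(y i / b)))
    (hex : ∀ i, QNonvanishing q (e / x i))
    (hex' : ∀ i, QNonvanishing q (q * a * b / (e * x i)))
    -- the denominators of the terms with `m_i ≤ N_i` of the multiple sum do not vanish
    (hmx : ∀ s, qPoch q (q * x s / e) (partialSum N s) ≠ 0)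
    (hmy : ∀ s, qPoch q (q * y s / e) (partialSum N s) ≠ 0) :
    Summable (rhoTerm q a b c d e x y (∑ i, N i)) ∧
    Summable (rhoTerm q b a c d e x y (∑ i, N i)) ∧
    Summable (fun m : Fin n → ℕ => multiTerm q a b c d e x y m) ∧
    rho q a b c d e x y (∑ i, N i) - rho q b a c d e x y (∑ i, N i) =
      fiveVarProduct q a b c d e
        * (∏ i, pairProduct q a b e (x i) (y i))
        * ∑' m : Fin n → ℕ, multiTerm q a b c d e x y m := by
  have hconv' : ‖c * d * (e / q ^ (0 + ∑ i, N i))‖ < ‖q * a * b‖ := by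
    have h0 : q * a * b ≠ 0 := by positivity
    rw [← div_lt_one (norm_pos_iff.2 h0), ← norm_div]
    have h1 : c * d * (e / q ^ (0 + ∑ i, N i)) / (q * a * b)
        = c * d * e / (a * b * q ^ ((∑ i, N i) + 1)) := by
      rw [zero_add, pow_succ]
      field_simp
    rwa [h1]
  obtain ⟨s1, s2, h⟩ := regPairTerm_summable_and_eq hq0 hq1 ha hb hc hd he hqa hqb n x y N 0
    hx hy hxy hxa hxb hya hyb hconv' (by simpa using hmx) (by simpa using hmy)
  have hab := regPairTerm_eq hq0 hq1 ha hb hc hd he hcb hdb heb x y N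
  have hba := regPairTerm_eq hq0 hq1 hb ha hc hd he hca hda hea x y N
  rw [← regScale_comm] at hba
  have hR : regScale q a b c d e ≠ 0 := by
    simp only [regScale]
    have := hca.qPochInf_ne_zero hq1
    have := hcb.qPochInf_ne_zero hq1
    have := hda.qPochInf_ne_zero hq1
    have := hdb.qPochInf_ne_zero hq1
    have := hea.qPochInf_ne_zero hq1
    have := heb.qPochInf_ne_zero hq1
    positivity
  have hz := fun m hm => multiTerm_eq_zero (m := m) ha hb c d e hx hy hxy hm
  rw [pow_zero, div_one] at s1 s2 h
  rw [funext hab, summable_mul_left_iff (mul_ne_zero hR (one_div_ne_zero (pow_ne_zero n hb)))] at s1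
  rw [funext hba, summable_mul_left_iff (mul_ne_zero hR (one_div_ne_zero (pow_ne_zero n ha)))] at s2
  refine ⟨s1, s2, summable_of_ne_finset_zero (fun m hm => hz m hm), ?_⟩
  simp only [hab, hba] at h
  rw [tsum_mul_left, tsum_mul_left] at h
  have hsp : shiftPow q a b e 0 = 1 := by simp [shiftPow]
  rw [hsp, one_mul] at h
  have hM : ∑' m : Fin n → ℕ, multiTerm q a b c d e x y m
      = ∑ m ∈ Fintype.piFinset fun i => Finset.range (N i + 1),
        shiftedMultiTerm q a b c d e 0 x y m := by
    rw [tsum_eq_sum (fun m hm => hz m hm)]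
    exact Finset.sum_congr rfl fun m _ => multiTerm_eq q a b c d e x y m
  have hP : ∏ i, pairProduct q a b e (x i) (y i)
      = ∏ i, finPairProduct q a b e (x i) (y i) (N i) :=
    Finset.prod_congr rfl fun i _ => pairProduct_eq hq0 hq1 ha hb he (hx i) (hy i) (hxy i) (hya i)
      (hyb i) (hex i) (hex' i)
  have hC : regScale q a b c d e * fiveVarProduct q a b c d e = regConst q a b c d e := by
    rw [fiveVarProduct_eq, mul_div_cancel₀ _ hR]
  apply mul_left_cancel₀ hR
  rw [rho, rho, hM, hP, ← mul_assoc, ← mul_assoc, hC, ← h]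
  ring
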